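/- Let $(e_k)_{k\in\mathbb N}$ be an orthonormal basis of $\ell_2=\ell_2(\mathbb N)$ over $\mathbb C$, with $\mathbb N=\{0,1,2,\dots\}$, and let $\pi:\mathcal B(\ell_2)\to\mathcal Q(\ell_2)=\mathcal B(\ell_2)/\mathcal K(\ell_2)$ be the quotient map onto the Calkin algebra. Let $\mathcal A_0$ be the set of all $T\in\mathcal B(\ell_2)$ such that, for all $k,m\in\mathbb N$, $\langle Te_k,e_m\rangle\neq 0$ implies $\{k,m\}\subseteq\{2n,2n+1\}$ for some $n\in\mathbb N$; for $T\in\mathcal A_0$ let $T_n$ be the restriction of $T$ to $\mathrm{span}\{e_{2n},e_{2n+1}\}$. For $X\subseteq\mathbb N$ let $P_X$ be the orthogonal projection onto the closed linear span of $\{e_{2k},e_{2k+1}:k\in X\}$, and let $\mathcal A_0(X)=\{T\in\mathcal A_0: T_n=0\text{ for all }n\in\mathbb N\setminus X\}$. For $\alpha\in(71/72,1]$ and $n\in\mathbb N$ put $$f_{\alpha,2n}=\alpha e_{2n}+\sqrt{1-\alpha^2}\,e_{2n+1},\qquad f_{\alpha,2n+1}=\sqrt{1-\alpha^2}\,e_{2n}-\alpha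 e_{2n+1}.$$ Let $\mathcal D(X,\alpha)$ be the set of all $T\in\mathcal A_0(X)$ such that for every $n\in X$ the operator $T_n$ is diagonal with respect to the basis $\{f_{\alpha,2n},f_{\alpha,2n+1}\}$, i.e. both basis vectors are eigenvectors of $T_n$, and let $\mathcal D_{\mathcal K}(X,\alpha)$ be the set of all $T\in\mathcal A_0(X)$ of the form $T=S+R$ with $S\in\mathcal D(X,\alpha)$ and $R\in\mathcal K(\ell_2)\cap\mathcal A_0(X)$. A family $\mathcal X$ of subsets of $\mathbb N$ is called wide if for every infinite $X'\subseteq\mathbb N$ there is $X\in\mathcal X$ such that $X\cap X'$ is infinite. A system $\mathfrak A=(\alpha_X:X\in\mathcal X)$ is called coherent if $\alpha_X\in(71/72,1]$ for all $X\in\mathcal X$ and $\alpha_X=\alpha_Y$ whenever $X,Y\in\mathcal X$ and $X\cap Y$ is infinite. Define $$\mathcal M_{\mathcal X,\mathfrak A}=\bigcap_{X\in\mathcal X}\{T\in\mathcal A_0: P_XTP_X\in\mathcal D_{\mathcal K}(X,\alpha_X)\}.$$ Proposition. If $\mathcal X$ is a wide family of subsets of $\mathbb N$ and $\mathfrak A=(\alpha_X:X\in\mathcal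 X)$ is coherent, then $\pi[\mathcal M_{\mathcal X,\mathfrak A}]$ is a masa of $\mathcal Q(\ell_2)$, that is, a maximal (with respect to inclusion) commutative unital C*-subalgebra of $\mathcal Q(\ell_2)$, and it is generated by projections, that is, it is the C*-algebra generated by the elements $p=p^2=p^*$ that it contains. -/

import Mathlib

open scoped InnerProductSpace

noncomputable section

/-! ### The Calkin algebra of `ℓ₂` -/

/-- The Hilbert space `ℓ₂ = ℓ₂(ℕ)` over the complex numbers. -/
abbrev Ell2 : Type := lp (fun _ : ℕ => ℂ) 2

/-- The C*-algebra of all bounded operators on `ℓ₂`. -/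
abbrev BddOp : Type := Ell2 →L[ℂ] Ell2

/-- The ideal of compact operators on `ℓ₂`. -/
def compactIdeal : Ideal BddOp where
  carrier := {T | IsCompactOperator T}
  add_mem' hS hT := hS.add hT
  zero_mem' := isCompactOperator_zero
  smul_mem' S _ hT := IsCompactOperator.clm_comp hT S

theorem mem_compactIdeal {T : BddOp} : T ∈ compactIdeal ↔ IsCompactOperator T := Iff.rfl

instance compactIdeal_isTwoSided : compactIdeal.IsTwoSided where
  mul_mem_of_left S hT := IsCompactOperator.comp_clm hT S

instance compactIdeal_isClosed : IsClosed (compactIdeal : Set BddOp) :=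
  isClosed_setOfPred_isCompactOperator

/-- The adjoint of a compact operator is compact. -/
theorem star_mem_compactIdeal {T : BddOp} (hT : T ∈ compactIdeal) : star T ∈ compactIdeal := by
  have hc : T * star T ∈ compactIdeal := compactIdeal_isTwoSided.mul_mem_of_left _ hT
  rw [mem_compactIdeal] at hc ⊢
  refine (isCompactOperator_iff_isCompact_closure_image_ball
    ((star T : BddOp) : Ell2 →ₗ[ℂ] Ell2) one_pos).2 ?_
  have hK := (isCompactOperator_iff_isCompact_closure_image_ball
    ((T * star T : BddOp) : Ell2 →ₗ[ℂ] Ell2) one_pos).1 hc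
  have hb := hK.totallyBounded.subset subset_closure
  refine (TotallyBounded.closure ?_).isCompact_of_isClosed isClosed_closure
  rw [Metric.totallyBounded_iff]
  intro ε hε
  obtain ⟨t, hts, htf, hcov⟩ :=
    Metric.finite_approx_of_totallyBounded hb (ε ^ 2 / 2) (by positivity)
  have hts' : ∀ y ∈ t, ∃ x : Ell2, x ∈ Metric.ball (0 : Ell2) 1 ∧ T (star T x) = y := hts
  choose! g hg hgt using hts'
  refine ⟨(fun y => star T (g y)) '' t, htf.image _, ?_⟩
  rintro _ ⟨x, hx, rfl⟩
  obtain ⟨y, hy, hxy⟩ := Set.mem_iUnion₂.1 (hcov ⟨x, hx, rfl⟩)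
  refine Set.mem_iUnion₂.2 ⟨_, ⟨y, hy, rfl⟩, ?_⟩
  have hgy := hg y hy
  have hyy := hgt y hy
  rw [mem_ball_zero_iff] at hx hgy
  rw [Metric.mem_ball, dist_eq_norm] at hxy ⊢
  rw [← hyy] at hxy
  have e1 : T (star T (x - g y)) = T (star T x) - T (star T (g y)) := by simp
  have e2 : star T (x - g y) = star T x - star T (g y) := by simp
  change ‖T (star T x) - T (star T (g y))‖ < ε ^ 2 / 2 at hxy
  change ‖star T x - star T (g y)‖ < ε
  rw [← e1] at hxy
  rw [← e2]
  have hxg : ‖x - g y‖ ≤ 2 := (norm_sub_le _ _).trans (by linarith)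
  have h1 : ‖star T (x - g y)‖ ^ 2 ≤ ‖T (star T (x - g y))‖ * ‖x - g y‖ := by
    have h2 : ⟪star T (x - g y), star T (x - g y)⟫_ℂ = ⟪T (star T (x - g y)), x - g y⟫_ℂ := by
      rw [ContinuousLinearMap.star_eq_adjoint, ContinuousLinearMap.adjoint_inner_right]
    rw [← inner_self_eq_norm_sq (𝕜 := ℂ), h2]
    exact (RCLike.re_le_norm _).trans (norm_inner_le_norm _ _)
  have h3 := norm_nonneg (T (star T (x - g y)))
  nlinarith [norm_nonneg (star T (x - g y)), norm_nonneg (x - g y)]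

/-- The Calkin algebra, the quotient of the bounded operators by the compact ones. -/
def Calkin : Type := BddOp ⧸ compactIdeal

namespace Calkin

instance instRing : Ring Calkin := inferInstanceAs (Ring (BddOp ⧸ compactIdeal))

instance instAlgebra : Algebra ℂ Calkin := inferInstanceAs (Algebra ℂ (BddOp ⧸ compactIdeal))

/-- The quotient map from the bounded operators onto the Calkin algebra. -/
def π : BddOp →ₐ[ℂ] Calkin := Ideal.Quotient.mkₐ ℂ compactIdeal

theorem π_surjective : Function.Surjective π := Ideal.Quotient.mk_surjective

theorem π_eq_iff {S T : BddOp} : π S = π T ↔ IsCompactOperator (S - T : BddOp) :=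
  Ideal.Quotient.eq

instance instStar : Star Calkin where
  star := Quotient.map' (fun T : BddOp => star T) (by
    intro S T h
    rw [Submodule.quotientRel_def] at h ⊢
    rw [← star_sub]
    exact star_mem_compactIdeal h)

theorem star_π (T : BddOp) : star (π T) = π (star T) := rfl

/-- The involution of the Calkin algebra, the adjoint on representatives. -/
instance instStarRing : StarRing Calkin where
  star_involutive x := by
    obtain ⟨T, rfl⟩ := π_surjective x
    rw [star_π, star_π, star_star]
  star_mul x y := by
    obtain ⟨S, rfl⟩ := π_surjective x
    obtain ⟨T, rfl⟩ := π_surjective y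
    rw [← map_mul, star_π, star_π, star_π, star_mul, map_mul]
  star_add x y := by
    obtain ⟨S, rfl⟩ := π_surjective x
    obtain ⟨T, rfl⟩ := π_surjective y
    rw [← map_add, star_π, star_π, star_π, star_add, map_add]

instance instStarModule : StarModule ℂ Calkin where
  star_smul c x := by
    obtain ⟨S, rfl⟩ := π_surjective x
    rw [← map_smul, star_π, star_π, star_smul, map_smul]

instance instNormedAddCommGroup : NormedAddCommGroup Calkin :=
  inferInstanceAs (NormedAddCommGroup (BddOp ⧸ compactIdeal))

theorem norm_π_le (T : BddOp) : ‖π T‖ ≤ ‖T‖ := Submodule.Quotient.norm_mk_le compactIdeal T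

theorem exists_norm_lt (x : Calkin) {ε : ℝ} (hε : 0 < ε) : ∃ T : BddOp, π T = x ∧ ‖T‖ < ‖x‖ + ε :=
  Submodule.Quotient.norm_mk_lt (S := compactIdeal) x hε

/-- The Calkin algebra is a normed ring under the quotient norm. -/
instance instNormedRing : NormedRing Calkin :=
  { Calkin.instNormedAddCommGroup, Calkin.instRing with
    norm_mul_le := fun x y => by
      have key : ∀ ε : ℝ, 0 < ε → ‖x * y‖ ≤ (‖x‖ + ε) * (‖y‖ + ε) := by
        intro ε hε
        obtain ⟨S, rfl, hS⟩ := exists_norm_lt x hε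
        obtain ⟨T, rfl, hT⟩ := exists_norm_lt y hε
        calc ‖π S * π T‖ = ‖π (S * T)‖ := by rw [map_mul]
          _ ≤ ‖S * T‖ := norm_π_le _
          _ ≤ ‖S‖ * ‖T‖ := norm_mul_le _ _
          _ ≤ _ := by gcongr
      have hlim : Filter.Tendsto (fun ε : ℝ => (‖x‖ + ε) * (‖y‖ + ε)) (nhdsWithin 0 (Set.Ioi 0))
          (nhds (‖x‖ * ‖y‖)) := by
        have : Continuous fun ε : ℝ => (‖x‖ + ε) * (‖y‖ + ε) := by fun_prop
        simpa using (this.tendsto 0).mono_left nhdsWithin_le_nhds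
      exact ge_of_tendsto hlim (Filter.eventually_of_mem self_mem_nhdsWithin key) }

instance instNormedAlgebra : NormedAlgebra ℂ Calkin :=
  { Calkin.instAlgebra with
    norm_smul_le := fun c x =>
      (inferInstance : NormedSpace ℂ (BddOp ⧸ compactIdeal)).norm_smul_le c x }

/-- A masa of the Calkin algebra: a maximal element, with respect to inclusion, among the
commutative C*-subalgebras (closed, unital, self-adjoint subalgebras). -/
def IsMasa (A : StarSubalgebra ℂ Calkin) : Prop :=
  Maximal (fun B : StarSubalgebra ℂ Calkin =>
    IsClosed (B : Set Calkin) ∧ ∀ x ∈ B, ∀ y ∈ B, x * y = y * x) A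

/-- A C*-subalgebra of the Calkin algebra is generated by projections if it is the norm closure of
the *-algebra generated by the projections `p = p² = p*` that belong to it. -/
def IsGeneratedByProjections (A : StarSubalgebra ℂ Calkin) : Prop :=
  (A : Set Calkin) = closure (StarAlgebra.adjoin ℂ {p : Calkin | p ∈ A ∧ IsStarProjection p} :
    StarSubalgebra ℂ Calkin)

end Calkin

/-! ### Block operators with respect to an orthonormal basis `e` of `ℓ₂` -/

section Blocks

variable (e : HilbertBasis ℕ ℂ Ell2)

/-- `P_X`, the orthogonal projection onto the closed linear span of
`{e (2 * k), e (2 * k + 1) | k ∈ X}`. -/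
def blockProj (X : Set ℕ) : BddOp :=
  (Submodule.span ℂ {v : Ell2 | ∃ k ∈ X, v = e (2 * k) ∨ v = e (2 * k + 1)}).topologicalClosure
    |>.starProjection

/-- `𝒜₀`, the set of the operators which are block diagonal with the 2 × 2 blocks on
`span {e (2 * n), e (2 * n + 1)}`. -/
def blockDiag : Set BddOp :=
  {T | ∀ k m : ℕ, ⟪T (e k), e m⟫_ℂ ≠ 0 → ∃ n : ℕ, ({k, m} : Set ℕ) ⊆ {2 * n, 2 * n + 1}}

/-- `𝒜₀(X)`, the set of the operators `T = (T_n)` in `𝒜₀` with `T_n = 0` for all `n ∉ X`. Here `T_n`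
is the restriction of `T` to the `n`-th block `span {e (2 * n), e (2 * n + 1)}`. -/
def blockDiagOn (X : Set ℕ) : Set BddOp :=
  {T | T ∈ blockDiag e ∧ ∀ n, n ∉ X → T (e (2 * n)) = 0 ∧ T (e (2 * n + 1)) = 0}

/-- The vector `f_{α, 2n} = α e_{2n} + √(1 - α²) e_{2n+1}`. -/
def rotEven (α : ℝ) (n : ℕ) : Ell2 :=
  (α : ℂ) • e (2 * n) + (Real.sqrt (1 - α ^ 2) : ℂ) • e (2 * n + 1)

/-- The vector `f_{α, 2n+1} = √(1 - α²) e_{2n} - α e_{2n+1}`. -/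
def rotOdd (α : ℝ) (n : ℕ) : Ell2 :=
  (Real.sqrt (1 - α ^ 2) : ℂ) • e (2 * n) - (α : ℂ) • e (2 * n + 1)

/-- `𝒟(X, α)`, the set of the operators `T = (T_n)` in `𝒜₀(X)` such that, for every `n ∈ X`, the
block `T_n` is diagonal with respect to the orthonormal basis `{f_{α, 2n}, f_{α, 2n+1}}` of the
`n`-th block, that is, both basis vectors are eigenvectors. -/
def rotDiag (X : Set ℕ) (α : ℝ) : Set BddOp :=
  {T | T ∈ blockDiagOn e X ∧ ∀ n ∈ X,
    (∃ a : ℂ, T (rotEven e α n) = a • rotEven e α n) ∧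
    ∃ b : ℂ, T (rotOdd e α n) = b • rotOdd e α n}

/-- `𝒟_𝒦(X, α)`, the set of the operators in `𝒜₀(X)` which are of the form `S + R` with
`S ∈ 𝒟(X, α)` and `R ∈ 𝒜₀(X)` compact. -/
def rotDiagCompact (X : Set ℕ) (α : ℝ) : Set BddOp :=
  {T | T ∈ blockDiagOn e X ∧ ∃ S ∈ rotDiag e X α, ∃ R ∈ blockDiagOn e X,
    IsCompactOperator R ∧ T = S + R}

/-- The algebra `ℳ_{𝒳, 𝔄}` for a family `𝒳` of subsets of `ℕ` and a system `𝔄 = (α X : X ∈ 𝒳)`. -/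
def blockAlgebra (𝒳 : Set (Set ℕ)) (α : 𝒳 → ℝ) : Set BddOp :=
  {T | T ∈ blockDiag e ∧
    ∀ X : 𝒳, blockProj e X * T * blockProj e X ∈ rotDiagCompact e X (α X)}

end Blocks

/-- A family of subsets of `ℕ` is wide if every infinite subset of `ℕ` has an infinite intersection
with some member of the family. -/
def IsWide (𝒳 : Set (Set ℕ)) : Prop :=
  ∀ Y : Set ℕ, Y.Infinite → ∃ X ∈ 𝒳, (X ∩ Y).Infinite

/-- A system `(α X : X ∈ 𝒳)` is coherent if its terms lie in `(71/72, 1]` and agree on any two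
members of `𝒳` with infinite intersection. -/
def IsCoherent (𝒳 : Set (Set ℕ)) (α : 𝒳 → ℝ) : Prop :=
  (∀ X : 𝒳, α X ∈ Set.Ioc (71 / 72 : ℝ) 1) ∧
    ∀ X Y : 𝒳, ((X : Set ℕ) ∩ (Y : Set ℕ)).Infinite → α X = α Y

end

/-!
A block diagonal operator `T` satisfies `P_X T P_X ∈ 𝒟_𝒦(X, α)` exactly when `π T` commutes with `π r`,
where `r` is the projection onto the closed span of `{f_{α, 2n} : n ∈ X}`
(`compression_mem_rotDiagCompact_iff`): the compact perturbation is the off-diagonal part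
`r T (P_X - r) + (P_X - r) T r`. So `ℳ` is the set of the `T ∈ 𝒜₀` for which `π T` commutes with the
set `𝒢` (`generatorSet`) consisting of all `π P_Y`, `Y ⊆ ℕ`, and of the projections `π r` for
`X ∈ 𝒳`, `α = α_X`.

The main point is that `π[ℳ]` is the whole commutant of `𝒢` in the Calkin algebra (`coe_blockMasa`).
An operator `T` commuting modulo compact operators with all `P_Y` is a compact perturbation of its
block diagonal part (`isCompactOperator_sub_blockPart`), which is the block version of the
Johnson–Parrott theorem for atomic masas. If the difference `V` were not compact, it would have
compressions to infinitely many disjoint finite sets `F` of blocks with norms bounded below. As `V`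
has no diagonal blocks, its compression to `F` is four times the average of the corners
`P_G V P_{F \ G}`, `G ⊆ F` (`sum_powerset_corners`), so some of these corners are large too; a union
`Y` of such sets `G` gives a corner `P_Y V (1 - P_Y)` which is not compact.

As a commutant of a self-adjoint set, `π[ℳ]` is a closed star subalgebra, and it is a masa as soon
as it is commutative and contains `𝒢`. Coherence yields `𝒢 ⊆ π[ℳ]` (`commute_π_rotProj`). For
commutativity, a commutator of two elements of `ℳ` is compact on the blocks in each `X ∈ 𝒳`, hence
its blocks tend to zero because `𝒳` is wide (`isCompactOperator_of_wide`).

For the generation by projections let `T ∈ ℳ` be self-adjoint. After subtracting half the trace from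
each block, `T` becomes `S` with `S² = ⨁ ρ_n` a block scalar. On the blocks with `ρ_n ≥ ε²`,
`S / √ρ_n` is a self-adjoint unitary, so `½ (1 + S / √ρ_n)` is a projection; it lies in `π[ℳ]` since
block scalars do. The rest of `S` has norm at most `ε` (`exists_spectral_approx`), and block scalars
are limits of linear combinations of the projections `P_Y`.
-/

open Filter Topology

/-! ### Bounded sequences and compact operators -/

/-- Bounded complex sequences, the C*-algebra `ℓ_∞`. -/
abbrev BddSeq : Type := lp (fun _ : ℕ => ℂ) ⊤

/-- A pointwise bounded sequence as an element of `ℓ_∞`. -/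
noncomputable def BddSeq.ofBound (c : ℕ → ℂ) (C : ℝ) (h : ∀ n, ‖c n‖ ≤ C) : BddSeq :=
  ⟨c, memℓp_infty ⟨C, by rintro _ ⟨n, rfl⟩; exact h n⟩⟩

@[simp]
theorem BddSeq.ofBound_apply (c : ℕ → ℂ) (C : ℝ) (h : ∀ n, ‖c n‖ ≤ C) (n : ℕ) :
    BddSeq.ofBound c C h n = c n := rfl

theorem BddSeq.norm_apply_le (c : BddSeq) (n : ℕ) : ‖c n‖ ≤ ‖c‖ :=
  lp.norm_apply_le_norm ENNReal.top_ne_zero c n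

theorem BddSeq.norm_ofBound_le (c : ℕ → ℂ) (C : ℝ) (h : ∀ n, ‖c n‖ ≤ C) :
    ‖BddSeq.ofBound c C h‖ ≤ C :=
  lp.norm_le_of_forall_le ((norm_nonneg _).trans (h 0)) h

/-- The indicator sequence of a set of natural numbers. -/
noncomputable def BddSeq.ind (X : Set ℕ) : BddSeq :=
  BddSeq.ofBound (X.indicator 1) 1 fun n => by
    by_cases h : n ∈ X <;> simp [h]

theorem BddSeq.ind_of_mem {X : Set ℕ} {n : ℕ} (h : n ∈ X) : BddSeq.ind X n = 1 := by
  simp [BddSeq.ind, h]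

theorem BddSeq.ind_of_notMem {X : Set ℕ} {n : ℕ} (h : n ∉ X) : BddSeq.ind X n = 0 := by
  simp [BddSeq.ind, h]

/-- Weak convergence to zero of a bounded sequence becomes norm convergence under a compact
operator. -/
theorem IsCompactOperator.tendsto_zero_of_weakly_null {C : BddOp} (hC : IsCompactOperator C)
    {x : ℕ → Ell2} {r : ℝ} (hb : ∀ n, ‖x n‖ ≤ r)
    (hx : ∀ z : Ell2, Tendsto (fun n => ⟪z, x n⟫_ℂ) atTop (𝓝 0)) :
    Tendsto (fun n => C (x n)) atTop (𝓝 0) := by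
  obtain ⟨K, hK, hKs⟩ := hC.image_closedBall_subset_compact r
  have hm : ∀ n, C (x n) ∈ K := fun n => hKs ⟨x n, by simpa using hb n, rfl⟩
  refine tendsto_of_subseq_tendsto fun ns hns => ?_
  obtain ⟨y, -, φ, hφ, hy⟩ := hK.tendsto_subseq (fun n => hm (ns n))
  refine ⟨φ, ?_⟩
  have h1 : Tendsto (fun n => ⟪y, C (x (ns (φ n)))⟫_ℂ) atTop (𝓝 ⟪y, y⟫_ℂ) :=
    (tendsto_const_nhds (x := y)).inner hy
  have h2 : Tendsto (fun n => ⟪y, C (x (ns (φ n)))⟫_ℂ) atTop (𝓝 0) := by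
    have := (hx (ContinuousLinearMap.adjoint C y)).comp (hns.comp hφ.tendsto_atTop)
    refine this.congr fun n => ?_
    simp [ContinuousLinearMap.adjoint_inner_left]
  have h3 : y = 0 := inner_self_eq_zero.1 (tendsto_nhds_unique h1 h2)
  simpa [h3, Function.comp_def] using hy

section Blocks

variable (e : HilbertBasis ℕ ℂ Ell2)

theorem clm_ext_of_basis (e : HilbertBasis ℕ ℂ Ell2) {S T : BddOp} (h : ∀ k, S (e k) = T (e k)) :
    S = T :=
  ContinuousLinearMap.ext_on (s := Set.range e)
    (by
      have := e.dense_span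
      rw [Submodule.dense_iff_topologicalClosure_eq_top]
      exact this)
    (by rintro _ ⟨k, rfl⟩; exact h k)

theorem vec_ext_of_basis (e : HilbertBasis ℕ ℂ Ell2) {x y : Ell2}
    (h : ∀ k, ⟪e k, x⟫_ℂ = ⟪e k, y⟫_ℂ) : x = y := by
  apply e.repr.injective
  ext k
  rw [e.repr_apply_apply, e.repr_apply_apply, h]

theorem inner_basis (j k : ℕ) : ⟪e j, e k⟫_ℂ = if j = k then 1 else 0 :=
  orthonormal_iff_ite.1 e.orthonormal j k

theorem norm_basis (k : ℕ) : ‖e k‖ = 1 := e.orthonormal.1 k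

theorem tendsto_inner_basis (z : Ell2) : Tendsto (fun n => ⟪z, e n⟫_ℂ) atTop (𝓝 0) := by
  have h : Summable fun n => ‖⟪e n, z⟫_ℂ‖ ^ 2 := e.orthonormal.inner_products_summable z
  have h2 := h.tendsto_atTop_zero.sqrt
  rw [tendsto_zero_iff_norm_tendsto_zero]
  simp only [Real.sqrt_zero, Real.sqrt_sq (norm_nonneg _)] at h2
  simpa only [norm_inner_symm] using h2

theorem IsCompactOperator.tendsto_basis {C : BddOp} (hC : IsCompactOperator C) :
    Tendsto (fun k => C (e k)) atTop (𝓝 0) :=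
  hC.tendsto_zero_of_weakly_null (fun k => (norm_basis e k).le) (tendsto_inner_basis e)

/-! ### Weighted permutation operators and block scalars -/

theorem memℓp_weightedPerm (σ : Equiv.Perm ℕ) (c : BddSeq) (x : Ell2) :
    Memℓp (fun j => c j * x (σ j)) 2 := by
  apply memℓp_gen
  have h := (lp.memℓp x).summable (by norm_num)
  refine Summable.of_nonneg_of_le (fun _ => by positivity) (fun j => ?_)
    (((σ.summable_iff (f := fun i => ‖x i‖ ^ (2 : ENNReal).toReal)).2 h).mul_left (‖c‖ ^ 2))
  have := c.norm_apply_le j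
  simp only [ENNReal.toReal_ofNat, Real.rpow_ofNat, norm_mul, mul_pow, Function.comp]
  gcongr

/-- The operator on sequences `x ↦ (c j * x (σ j))_j`. -/
noncomputable def seqWeightedPerm (σ : Equiv.Perm ℕ) (c : BddSeq) : BddOp :=
  LinearMap.mkContinuous
    { toFun := fun x => ⟨fun j => c j * x (σ j), memℓp_weightedPerm σ c x⟩
      map_add' := fun x y => by ext j; exact mul_add _ _ _
      map_smul' := fun a x => by ext j; exact mul_left_comm _ _ _ } ‖c‖ (fun x => by
    refine lp.norm_le_of_forall_sum_le (by norm_num) (by positivity) fun s => ?_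
    have h : ∑ j ∈ s, ‖x (σ j)‖ ^ (2 : ENNReal).toReal ≤ ‖x‖ ^ (2 : ENNReal).toReal := by
      have := lp.sum_rpow_le_norm_rpow (p := 2) (by norm_num) x (s.map σ.toEmbedding)
      simpa using this
    simp only [ENNReal.toReal_ofNat, Real.rpow_ofNat] at h ⊢
    calc ∑ j ∈ s, ‖c j * x (σ j)‖ ^ 2 ≤ ∑ j ∈ s, ‖c‖ ^ 2 * ‖x (σ j)‖ ^ 2 := by
          refine Finset.sum_le_sum fun j _ => ?_
          have := c.norm_apply_le j
          rw [norm_mul, mul_pow]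
          gcongr
      _ ≤ (‖c‖ * ‖x‖) ^ 2 := by
          rw [← Finset.mul_sum, mul_pow]
          gcongr)

theorem norm_seqWeightedPerm_le (σ : Equiv.Perm ℕ) (c : BddSeq) : ‖seqWeightedPerm σ c‖ ≤ ‖c‖ :=
  LinearMap.mkContinuous_norm_le _ (norm_nonneg _) _

/-- The weighted permutation operator whose `j`-th coordinate functional with respect to the basis
`e` is `c j` times the `σ j`-th one. -/
noncomputable def weightedPerm (σ : Equiv.Perm ℕ) (c : BddSeq) : BddOp :=
  (e.repr.symm.toContinuousLinearEquiv : Ell2 →L[ℂ] Ell2) ∘L seqWeightedPerm σ c ∘L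
    (e.repr.toContinuousLinearEquiv : Ell2 →L[ℂ] Ell2)

theorem inner_weightedPerm (σ : Equiv.Perm ℕ) (c : BddSeq) (j : ℕ) (x : Ell2) :
    ⟪e j, weightedPerm e σ c x⟫_ℂ = c j * ⟪e (σ j), x⟫_ℂ := by
  rw [← e.repr_apply_apply, ← e.repr_apply_apply]
  simp [weightedPerm, seqWeightedPerm]

theorem norm_weightedPerm_le (σ : Equiv.Perm ℕ) (c : BddSeq) : ‖weightedPerm e σ c‖ ≤ ‖c‖ := by
  refine ContinuousLinearMap.opNorm_le_bound _ (norm_nonneg _) fun x => ?_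
  have := (seqWeightedPerm σ c).le_of_opNorm_le (norm_seqWeightedPerm_le σ c) (e.repr x)
  simpa [weightedPerm] using this

/-- The operator acting on the `n`-th block as the scalar `c n`. -/
noncomputable def blockScalar (c : BddSeq) : BddOp :=
  weightedPerm e 1 (BddSeq.ofBound (fun k => c (k / 2)) ‖c‖ fun k => c.norm_apply_le (k / 2))

theorem inner_blockScalar (c : BddSeq) (j : ℕ) (x : Ell2) :
    ⟪e j, blockScalar e c x⟫_ℂ = c (j / 2) * ⟪e j, x⟫_ℂ := by
  simp [blockScalar, inner_weightedPerm]

theorem blockScalar_basis (c : BddSeq) (k : ℕ) : blockScalar e c (e k) = c (k / 2) • e k := by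
  refine vec_ext_of_basis e fun j => ?_
  rw [inner_blockScalar, inner_smul_right, inner_basis]
  split_ifs with h <;> simp [h]

theorem norm_blockScalar_le (c : BddSeq) : ‖blockScalar e c‖ ≤ ‖c‖ :=
  (norm_weightedPerm_le e _ _).trans (BddSeq.norm_ofBound_le _ _ _)

theorem blockScalar_mul (c d : BddSeq) :
    blockScalar e c * blockScalar e d = blockScalar e (c * d) := by
  refine clm_ext_of_basis e fun k => ?_
  simp [blockScalar_basis, smul_smul, mul_comm, lp.infty_coeFn_mul]

theorem star_blockScalar (c : BddSeq) : star (blockScalar e c) = blockScalar e (star c) := by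
  refine clm_ext_of_basis e fun k => vec_ext_of_basis e fun j => ?_
  rw [ContinuousLinearMap.star_eq_adjoint, ContinuousLinearMap.adjoint_inner_right,
    blockScalar_basis, blockScalar_basis, inner_smul_left, inner_smul_right, inner_basis]
  split_ifs with h <;> simp [h, lp.star_apply]

/-! ### The projections `P_X` -/

theorem blockProj_basis_of_mem {X : Set ℕ} {k : ℕ} (h : k / 2 ∈ X) :
    blockProj e X (e k) = e k := by
  unfold blockProj
  rw [Submodule.starProjection_eq_self_iff]
  refine Submodule.le_topologicalClosure _ (Submodule.subset_span ⟨k / 2, h, ?_⟩)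
  rcases Nat.even_or_odd' k with ⟨n, rfl | rfl⟩
  · left; congr 1; omega
  · right; congr 1; omega

theorem blockProj_basis_of_notMem {X : Set ℕ} {k : ℕ} (h : k / 2 ∉ X) :
    blockProj e X (e k) = 0 := by
  unfold blockProj
  rw [Submodule.starProjection_apply_eq_zero_iff, Submodule.orthogonal_closure,
    Submodule.mem_orthogonal]
  intro u hu
  induction hu using Submodule.span_induction with
  | mem x hx =>
    obtain ⟨n, hn, rfl | rfl⟩ := hx <;>
    · rw [inner_basis, if_neg]
      rintro rfl
      exact h (by convert hn using 1; omega)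
  | zero => simp
  | add x y _ _ hx hy => rw [inner_add_left, hx, hy, add_zero]
  | smul a x _ hx => rw [inner_smul_left, hx, mul_zero]

theorem blockProj_eq (X : Set ℕ) : blockProj e X = blockScalar e (BddSeq.ind X) := by
  refine clm_ext_of_basis e fun k => ?_
  rw [blockScalar_basis]
  by_cases h : k / 2 ∈ X
  · rw [blockProj_basis_of_mem e h, BddSeq.ind_of_mem h, one_smul]
  · rw [blockProj_basis_of_notMem e h, BddSeq.ind_of_notMem h, zero_smul]

theorem isStarProjection_blockProj (X : Set ℕ) : IsStarProjection (blockProj e X) :=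
  isStarProjection_starProjection

theorem star_blockProj (X : Set ℕ) : star (blockProj e X) = blockProj e X :=
  (isStarProjection_blockProj e X).isSelfAdjoint

theorem norm_blockProj_le (X : Set ℕ) : ‖blockProj e X‖ ≤ 1 :=
  Submodule.starProjection_norm_le _

theorem blockProj_mul (X Y : Set ℕ) :
    blockProj e X * blockProj e Y = blockProj e (X ∩ Y) := by
  rw [blockProj_eq, blockProj_eq, blockProj_eq, blockScalar_mul]
  congr 1
  ext n
  by_cases hX : n ∈ X <;> by_cases hY : n ∈ Y <;>
    simp [lp.infty_coeFn_mul, BddSeq.ind, hX, hY]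

theorem blockProj_compl (X : Set ℕ) : blockProj e Xᶜ = 1 - blockProj e X := by
  refine clm_ext_of_basis e fun k => ?_
  by_cases h : k / 2 ∈ X
  · rw [blockProj_basis_of_notMem e (by simpa using h)]
    simp [blockProj_basis_of_mem e h]
  · rw [blockProj_basis_of_mem e (by simpa using h)]
    simp [blockProj_basis_of_notMem e h]

theorem isCompactOperator_blockProj {Y : Set ℕ} (hY : Y.Finite) :
    IsCompactOperator (blockProj e Y) := by
  set V := Submodule.span ℂ {v : Ell2 | ∃ k ∈ Y, v = e (2 * k) ∨ v = e (2 * k + 1)} with hV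
  have hfin : {v : Ell2 | ∃ k ∈ Y, v = e (2 * k) ∨ v = e (2 * k + 1)}.Finite := by
    refine ((hY.image fun k => e (2 * k)).union (hY.image fun k => e (2 * k + 1))).subset ?_
    rintro _ ⟨k, hk, rfl | rfl⟩
    · exact Or.inl ⟨k, hk, rfl⟩
    · exact Or.inr ⟨k, hk, rfl⟩
  have : FiniteDimensional ℂ V := FiniteDimensional.span_of_finite ℂ hfin
  have hc : IsClosed (V : Set Ell2) := Submodule.closed_of_finiteDimensional V
  have : FiniteDimensional ℂ V.topologicalClosure := by
    rw [hc.submodule_topologicalClosure_eq]; infer_instance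
  have : ProperSpace V.topologicalClosure := FiniteDimensional.proper ℂ _
  have h : IsCompactOperator V.topologicalClosure.orthogonalProjectionOnto :=
    isCompactOperator_of_locallyCompactSpace_dom _
  exact h.clm_comp V.topologicalClosure.subtypeL

end Blocks

section Blocks

variable (e : HilbertBasis ℕ ℂ Ell2)

/-! ### Block diagonal operators -/

variable {e}

theorem mem_blockDiag_iff_inner {T : BddOp} :
    T ∈ blockDiag e ↔ ∀ j k, j / 2 ≠ k / 2 → ⟪e j, T (e k)⟫_ℂ = 0 := by
  simp only [blockDiag, Set.mem_ofPred_eq]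
  refine ⟨fun h j k hjk => ?_, fun h k m hkm => ?_⟩
  · by_contra h0
    obtain ⟨n, hn⟩ := h k j (fun h1 => h0 (by rw [← inner_conj_symm, h1, map_zero]))
    have h1 := hn (Set.mem_insert k {j})
    have h2 := hn (Set.mem_insert_of_mem k (Set.mem_singleton j))
    simp only [Set.mem_insert_iff, Set.mem_singleton_iff] at h1 h2
    omega
  · refine ⟨k / 2, ?_⟩
    have h1 : m / 2 = k / 2 := by
      by_contra h1
      exact hkm (by rw [← inner_conj_symm, h m k h1, map_zero])
    intro x hx
    simp only [Set.mem_insert_iff, Set.mem_singleton_iff] at hx ⊢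
    omega

theorem inner_blockScalar_right {T : BddOp} (c : BddSeq) (j k : ℕ) :
    ⟪e j, (T * blockScalar e c) (e k)⟫_ℂ = c (k / 2) * ⟪e j, T (e k)⟫_ℂ := by
  rw [mul_apply_eq_comp, blockScalar_basis, map_smul, inner_smul_right]

theorem inner_blockScalar_left {T : BddOp} (c : BddSeq) (j k : ℕ) :
    ⟪e j, (blockScalar e c * T) (e k)⟫_ℂ = c (j / 2) * ⟪e j, T (e k)⟫_ℂ := by
  rw [mul_apply_eq_comp, inner_blockScalar]

theorem commute_blockScalar {T : BddOp} (hT : T ∈ blockDiag e) (c : BddSeq) :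
    Commute (blockScalar e c) T := by
  refine clm_ext_of_basis e fun k => vec_ext_of_basis e fun j => ?_
  rw [inner_blockScalar_left, inner_blockScalar_right]
  by_cases h : j / 2 = k / 2
  · rw [h]
  · rw [mem_blockDiag_iff_inner.1 hT j k h, mul_zero, mul_zero]

theorem commute_blockProj {T : BddOp} (hT : T ∈ blockDiag e) (X : Set ℕ) :
    Commute (blockProj e X) T := by
  rw [blockProj_eq]
  exact commute_blockScalar hT _

variable (e) in
/-- `𝒜₀` as a star subalgebra: the commutant of the projections `P_X`. -/
noncomputable def blockDiagAlgebra : StarSubalgebra ℂ BddOp :=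
  StarSubalgebra.centralizer ℂ (Set.range (blockProj e))

theorem mem_blockDiagAlgebra {T : BddOp} : T ∈ blockDiagAlgebra e ↔ T ∈ blockDiag e := by
  rw [blockDiagAlgebra, StarSubalgebra.mem_centralizer_iff]
  simp only [Set.forall_mem_range, star_blockProj, and_self]
  refine ⟨fun h => mem_blockDiag_iff_inner.2 fun j k hjk => ?_, fun h X => commute_blockProj h X⟩
  have h1 := congrArg (fun S : BddOp => ⟪e j, S (e k)⟫_ℂ) (h {k / 2})
  simp only [blockProj_eq, inner_blockScalar_left, inner_blockScalar_right] at h1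
  rw [BddSeq.ind_of_notMem (by simpa using hjk), BddSeq.ind_of_mem (by simp)] at h1
  simpa using h1.symm

theorem blockScalar_mem_blockDiag (c : BddSeq) : blockScalar e c ∈ blockDiag e := by
  rw [mem_blockDiag_iff_inner]
  intro j k hjk
  rw [inner_blockScalar, inner_basis, if_neg (by rintro rfl; exact hjk rfl), mul_zero]

theorem blockProj_mem_blockDiag (X : Set ℕ) : blockProj e X ∈ blockDiag e := by
  rw [blockProj_eq]
  exact blockScalar_mem_blockDiag _

theorem mul_mem_blockDiag {S T : BddOp} (hS : S ∈ blockDiag e) (hT : T ∈ blockDiag e) :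
    S * T ∈ blockDiag e := by
  rw [← mem_blockDiagAlgebra] at *
  exact mul_mem hS hT

theorem add_mem_blockDiag {S T : BddOp} (hS : S ∈ blockDiag e) (hT : T ∈ blockDiag e) :
    S + T ∈ blockDiag e := by
  rw [← mem_blockDiagAlgebra] at *
  exact add_mem hS hT

theorem sub_mem_blockDiag {S T : BddOp} (hS : S ∈ blockDiag e) (hT : T ∈ blockDiag e) :
    S - T ∈ blockDiag e := by
  rw [← mem_blockDiagAlgebra] at *
  exact sub_mem hS hT

theorem star_mem_blockDiag {S : BddOp} (hS : S ∈ blockDiag e) : star S ∈ blockDiag e := by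
  rw [← mem_blockDiagAlgebra] at *
  exact star_mem hS

theorem blockDiag_apply_even {T : BddOp} (hT : T ∈ blockDiag e) (n : ℕ) :
    T (e (2 * n)) = ⟪e (2 * n), T (e (2 * n))⟫_ℂ • e (2 * n) +
      ⟪e (2 * n + 1), T (e (2 * n))⟫_ℂ • e (2 * n + 1) := by
  refine vec_ext_of_basis e fun j => ?_
  rw [inner_add_right, inner_smul_right, inner_smul_right, inner_basis, inner_basis]
  by_cases h1 : j = 2 * n
  · subst h1; simp
  by_cases h2 : j = 2 * n + 1
  · subst h2; simp
  rw [mem_blockDiag_iff_inner.1 hT j (2 * n) (by omega), if_neg h1, if_neg h2]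
  simp

theorem blockDiag_apply_odd {T : BddOp} (hT : T ∈ blockDiag e) (n : ℕ) :
    T (e (2 * n + 1)) = ⟪e (2 * n), T (e (2 * n + 1))⟫_ℂ • e (2 * n) +
      ⟪e (2 * n + 1), T (e (2 * n + 1))⟫_ℂ • e (2 * n + 1) := by
  refine vec_ext_of_basis e fun j => ?_
  rw [inner_add_right, inner_smul_right, inner_smul_right, inner_basis, inner_basis]
  by_cases h1 : j = 2 * n
  · subst h1; simp
  by_cases h2 : j = 2 * n + 1
  · subst h2; simp
  rw [mem_blockDiag_iff_inner.1 hT j (2 * n + 1) (by omega), if_neg h1, if_neg h2]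
  simp

theorem clm_ext_of_blocks (e : HilbertBasis ℕ ℂ Ell2) {S T : BddOp}
    (h0 : ∀ n, S (e (2 * n)) = T (e (2 * n)))
    (h1 : ∀ n, S (e (2 * n + 1)) = T (e (2 * n + 1))) : S = T := by
  refine clm_ext_of_basis e fun k => ?_
  rcases Nat.even_or_odd' k with ⟨n, rfl | rfl⟩
  exacts [h0 n, h1 n]

theorem mem_blockDiagOn_iff {X : Set ℕ} {T : BddOp} :
    T ∈ blockDiagOn e X ↔ T ∈ blockDiag e ∧ T * blockProj e X = T := by
  simp only [blockDiagOn, Set.mem_ofPred_eq]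
  refine and_congr_right fun hT => ⟨fun h => ?_, fun h n hn => ?_⟩
  · refine clm_ext_of_blocks e (fun n => ?_) fun n => ?_ <;> by_cases hn : n ∈ X
    · rw [mul_apply_eq_comp, blockProj_basis_of_mem e (by convert hn using 1; omega)]
    · rw [mul_apply_eq_comp,
        blockProj_basis_of_notMem e (by convert hn using 2; omega), (h n hn).1, map_zero]
    · rw [mul_apply_eq_comp, blockProj_basis_of_mem e (by convert hn using 1; omega)]
    · rw [mul_apply_eq_comp,
        blockProj_basis_of_notMem e (by convert hn using 2; omega), (h n hn).2, map_zero]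
  · constructor
    · rw [← h, mul_apply_eq_comp,
        blockProj_basis_of_notMem e (by convert hn using 2; omega), map_zero]
    · rw [← h, mul_apply_eq_comp,
        blockProj_basis_of_notMem e (by convert hn using 2; omega), map_zero]

theorem blockProj_mul_self (X : Set ℕ) : blockProj e X * blockProj e X = blockProj e X :=
  (isStarProjection_blockProj e X).isIdempotentElem

theorem mul_blockProj_mem_blockDiagOn {T : BddOp} (hT : T ∈ blockDiag e) (X : Set ℕ) :
    T * blockProj e X ∈ blockDiagOn e X := by
  rw [mem_blockDiagOn_iff]
  exact ⟨mul_mem_blockDiag hT (blockProj_mem_blockDiag X), by rw [mul_assoc, blockProj_mul_self]⟩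

/-! ### The block diagonal part and compactness -/

/-- The permutation of the indices interchanging the two members of each block. -/
def blockSwap : Equiv.Perm ℕ :=
  Function.Involutive.toPerm (fun k => if k % 2 = 0 then k + 1 else k - 1) (by
    intro k
    dsimp only
    split_ifs <;> omega)

theorem blockSwap_apply (k : ℕ) : blockSwap k = if k % 2 = 0 then k + 1 else k - 1 := rfl

theorem blockSwap_div (k : ℕ) : blockSwap k / 2 = k / 2 := by
  rw [blockSwap_apply]; split_ifs <;> omega

theorem blockSwap_ne (k : ℕ) : k ≠ blockSwap k := by
  rw [blockSwap_apply]; split_ifs <;> omega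

theorem eq_or_eq_blockSwap {j k : ℕ} (h : j / 2 = k / 2) : k = j ∨ k = blockSwap j := by
  rw [blockSwap_apply]; split_ifs <;> omega

theorem norm_entry_le (T : BddOp) (j k : ℕ) : ‖⟪e j, T (e k)⟫_ℂ‖ ≤ ‖T‖ := by
  refine (norm_inner_le_norm _ _).trans ?_
  rw [norm_basis, one_mul]
  simpa [norm_basis] using T.le_opNorm (e k)

variable (e) in
/-- The sequence of the entries `⟨e_j, T e_{σ j}⟩` of an operator. -/
noncomputable def entrySeq (T : BddOp) (σ : Equiv.Perm ℕ) : BddSeq :=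
  BddSeq.ofBound (fun j => ⟪e j, T (e (σ j))⟫_ℂ) ‖T‖ fun _ => norm_entry_le T _ _

variable (e) in
/-- The block diagonal part `∑ₙ Qₙ T Qₙ` of an operator `T`, where `Qₙ` is the projection onto the
`n`-th block. -/
noncomputable def blockPart (T : BddOp) : BddOp :=
  weightedPerm e 1 (entrySeq e T 1) + weightedPerm e blockSwap (entrySeq e T blockSwap)

theorem inner_blockPart (T : BddOp) (j k : ℕ) :
    ⟪e j, blockPart e T (e k)⟫_ℂ = if j / 2 = k / 2 then ⟪e j, T (e k)⟫_ℂ else 0 := by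
  simp only [blockPart, add_apply, inner_add_right, inner_weightedPerm,
    inner_basis, entrySeq, BddSeq.ofBound_apply, Equiv.Perm.one_apply, mul_ite, mul_one, mul_zero]
  by_cases h : j / 2 = k / 2
  · rcases eq_or_eq_blockSwap h with rfl | rfl
    · simp [(blockSwap_ne k).symm]
    · simp [h, blockSwap_ne j]
  · have h1 : j ≠ k := by rintro rfl; exact h rfl
    have h2 : blockSwap j ≠ k := by rintro rfl; exact h (blockSwap_div j).symm
    simp [h, h1, h2]

theorem blockPart_mem_blockDiag (T : BddOp) : blockPart e T ∈ blockDiag e := by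
  rw [mem_blockDiag_iff_inner]
  intro j k h
  rw [inner_blockPart, if_neg h]

theorem blockPart_of_mem {T : BddOp} (hT : T ∈ blockDiag e) : blockPart e T = T := by
  refine clm_ext_of_basis e fun k => vec_ext_of_basis e fun j => ?_
  rw [inner_blockPart]
  split_ifs with h
  · rfl
  · rw [mem_blockDiag_iff_inner.1 hT j k h]

theorem isCompactOperator_weightedPerm (σ : Equiv.Perm ℕ) {c : BddSeq}
    (hc : Tendsto (fun n => c n) atTop (𝓝 0)) : IsCompactOperator (weightedPerm e σ c) := by
  have h : Tendsto (fun N => blockProj e (Set.Iio N) * weightedPerm e σ c) atTop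
      (𝓝 (weightedPerm e σ c)) := by
    rw [Metric.tendsto_atTop]
    intro ε hε
    obtain ⟨N, hN⟩ := Metric.tendsto_atTop.1 hc (ε / 2) (by positivity)
    refine ⟨N, fun M hM => ?_⟩
    let d : BddSeq := BddSeq.ofBound (fun k => if k / 2 < M then 0 else -c k) (ε / 2) fun k => by
      split_ifs with hk
      · simp only [norm_zero]; positivity
      · simpa using (hN k (by omega)).le
    have hd : blockProj e (Set.Iio M) * weightedPerm e σ c - weightedPerm e σ c =
        weightedPerm e σ d := by
      ext1 x
      refine vec_ext_of_basis e fun j => ?_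
      rw [sub_apply, inner_sub_right, mul_apply_eq_comp,
        blockProj_eq, inner_blockScalar, inner_weightedPerm, inner_weightedPerm]
      by_cases hj : j / 2 < M
      · rw [BddSeq.ind_of_mem (by simpa using hj)]
        simp [d, hj]
      · rw [BddSeq.ind_of_notMem (by simpa using hj)]
        simp [d, hj]
    rw [dist_eq_norm, hd]
    exact ((norm_weightedPerm_le e σ d).trans (BddSeq.norm_ofBound_le _ _ _)).trans_lt (by linarith)
  refine isCompactOperator_of_tendsto h (Eventually.of_forall fun N => ?_)
  exact (isCompactOperator_blockProj e (Set.finite_Iio N)).comp_clm _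

/-- A block diagonal operator is compact if its blocks tend to zero. -/
theorem isCompactOperator_of_mem_blockDiag {T : BddOp} (hT : T ∈ blockDiag e)
    (h : Tendsto (fun k => T (e k)) atTop (𝓝 0)) : IsCompactOperator T := by
  have key : ∀ σ : Equiv.Perm ℕ, Tendsto σ atTop atTop →
      Tendsto (fun n => entrySeq e T σ n) atTop (𝓝 0) := by
    intro σ hσ
    refine squeeze_zero_norm (fun n => ?_) (tendsto_zero_iff_norm_tendsto_zero.1 (h.comp hσ))
    refine (norm_inner_le_norm _ _).trans ?_
    rw [norm_basis, one_mul, Function.comp]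
  rw [← blockPart_of_mem hT]
  have hσ : ∀ σ : Equiv.Perm ℕ, Tendsto σ atTop atTop := fun σ => by
    simpa [Nat.cofinite_eq_atTop] using σ.injective.tendsto_cofinite
  exact (isCompactOperator_weightedPerm 1 (key 1 (hσ _))).add
    (isCompactOperator_weightedPerm blockSwap (key blockSwap (hσ _)))

end Blocks

section Blocks

variable {e : HilbertBasis ℕ ℂ Ell2}

/-! ### Operators commuting with all the projections `P_X` modulo compact operators -/

theorem tendsto_blockProj_Iio (e : HilbertBasis ℕ ℂ Ell2) (x : Ell2) :
    Tendsto (fun M => blockProj e (Set.Iio M) x) atTop (𝓝 x) := by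
  have h := (e.hasSum_repr x).tendsto_sum_nat.comp
    (tendsto_id.const_mul_atTop' (show 0 < 2 by norm_num))
  refine h.congr fun M => vec_ext_of_basis e fun j => ?_
  rw [blockProj_eq, inner_blockScalar, Function.comp, inner_sum]
  simp only [inner_smul_right, inner_basis, mul_ite, mul_one, mul_zero, Finset.sum_ite_eq,
    Finset.mem_range, e.repr_apply_apply, id]
  by_cases hj : j / 2 < M
  · rw [if_pos (by omega), BddSeq.ind_of_mem (by simpa using hj), one_mul]
  · rw [if_neg (by omega), BddSeq.ind_of_notMem (by simpa using hj), zero_mul]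

theorem norm_blockProj_apply_le (X : Set ℕ) (x : Ell2) : ‖blockProj e X x‖ ≤ ‖x‖ := by
  simpa using (blockProj e X).le_of_opNorm_le (norm_blockProj_le e X) x

/-- An operator is bounded by the norms of its compressions to finitely many blocks. -/
theorem norm_le_of_finite_compressions {A : BddOp} {δ : ℝ}
    (h : ∀ M : ℕ, ‖blockProj e (Set.Iio M) * A * blockProj e (Set.Iio M)‖ ≤ δ) : ‖A‖ ≤ δ := by
  have hδ : 0 ≤ δ := (norm_nonneg _).trans (h 0)
  refine ContinuousLinearMap.opNorm_le_bound _ hδ fun x => ?_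
  have h1 : ∀ M, ‖A (blockProj e (Set.Iio M) x)‖ ≤ δ * ‖x‖ := by
    intro M
    refine le_of_tendsto (tendsto_blockProj_Iio e _).norm ?_
    filter_upwards [eventually_ge_atTop M] with L hL
    have h2 : blockProj e (Set.Iio L) (A (blockProj e (Set.Iio M) x)) =
        (blockProj e (Set.Iio L) * A * blockProj e (Set.Iio L)) (blockProj e (Set.Iio M) x) := by
      have h3 : blockProj e (Set.Iio L) (blockProj e (Set.Iio M) x) =
          blockProj e (Set.Iio M) x := by
        rw [← mul_apply_eq_comp, blockProj_mul,
          Set.inter_eq_right.2 (Set.Iio_subset_Iio hL)]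
      rw [mul_apply_eq_comp, mul_apply_eq_comp, h3]
    rw [h2]
    refine ((blockProj e (Set.Iio L) * A * blockProj e (Set.Iio L)).le_of_opNorm_le (h L) _).trans ?_
    gcongr
    exact norm_blockProj_apply_le _ _
  exact le_of_tendsto ((A.continuous.tendsto _).comp (tendsto_blockProj_Iio e x)).norm
    (Eventually.of_forall h1)

theorem inner_blockProj_mul_mul (V : BddOp) (X Y : Set ℕ) (j k : ℕ) :
    ⟪e j, (blockProj e X * V * blockProj e Y) (e k)⟫_ℂ =
      BddSeq.ind X (j / 2) * BddSeq.ind Y (k / 2) * ⟪e j, V (e k)⟫_ℂ := by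
  rw [blockProj_eq e Y, inner_blockScalar_right, blockProj_eq, inner_blockScalar_left]
  ring

/-- A quarter of the subsets of `F` contain `n` but not `m`. -/
theorem card_powerset_separating {F : Finset ℕ} {n m : ℕ} (hn : n ∈ F) (hm : m ∈ F) (hnm : n ≠ m) :
    4 * (F.powerset.filter fun G => n ∈ G ∧ m ∉ G).card = 2 ^ F.card := by
  have h1 : (F.powerset.filter fun G => n ∈ G ∧ m ∉ G) = Finset.Icc {n} (F.erase m) := by
    ext G
    simp only [Finset.mem_filter, Finset.mem_powerset, Finset.mem_Icc,
      Finset.singleton_subset_iff, Finset.subset_erase]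
    tauto
  have h2 : ({n} : Finset ℕ) ⊆ F.erase m := by simp [hn, hnm]
  have h3 : F.card = F.card - 1 - 1 + 2 := by
    have := Finset.card_le_card h2
    rw [Finset.card_erase_of_mem hm, Finset.card_singleton] at this
    omega
  rw [h1, Finset.card_Icc_finset h2, Finset.card_erase_of_mem hm, Finset.card_singleton]
  conv_rhs => rw [h3, pow_add]
  ring

/-- If the diagonal blocks of `V` vanish, then a compression of `V` is the average, up to the
factor `4`, of its off-diagonal corners. -/
theorem sum_powerset_corners {V : BddOp} (hV : ∀ j k, j / 2 = k / 2 → ⟪e j, V (e k)⟫_ℂ = 0)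
    (F : Finset ℕ) :
    (4 : ℂ) • ∑ G ∈ F.powerset, blockProj e G * V * blockProj e ((F : Set ℕ) \ G) =
      (2 : ℂ) ^ F.card • (blockProj e F * V * blockProj e F) := by
  refine clm_ext_of_basis e fun k => vec_ext_of_basis e fun j => ?_
  simp only [smul_apply, sum_apply, inner_smul_right,
    inner_sum, inner_blockProj_mul_mul]
  rw [← Finset.sum_mul]
  by_cases h : j / 2 = k / 2
  · rw [hV j k h]; simp
  rw [← mul_assoc, ← mul_assoc]
  congr 1
  by_cases hj : j / 2 ∈ F
  swap
  · rw [BddSeq.ind_of_notMem (by simpa using hj), zero_mul, mul_zero]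
    refine mul_eq_zero_of_right _ (Finset.sum_eq_zero fun G hG => ?_)
    rw [BddSeq.ind_of_notMem (by simpa using fun h1 => hj (Finset.mem_powerset.1 hG h1)), zero_mul]
  by_cases hk : k / 2 ∈ F
  swap
  · rw [BddSeq.ind_of_notMem (X := F) (n := k / 2) (by simpa using hk), mul_zero, mul_zero]
    refine mul_eq_zero_of_right _ (Finset.sum_eq_zero fun G hG => ?_)
    rw [BddSeq.ind_of_notMem (X := _ \ _) (by simp [hk]), mul_zero]
  rw [BddSeq.ind_of_mem (by simpa using hj), BddSeq.ind_of_mem (by simpa using hk), mul_one, mul_one]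
  have h1 : ∀ G ∈ F.powerset, BddSeq.ind (G : Set ℕ) (j / 2) *
      BddSeq.ind ((F : Set ℕ) \ G) (k / 2) = if j / 2 ∈ G ∧ k / 2 ∉ G then 1 else 0 := by
    intro G _
    by_cases h1 : j / 2 ∈ G <;> by_cases h2 : k / 2 ∈ G <;> simp [BddSeq.ind, h1, h2, hk]
  rw [Finset.sum_congr rfl h1, Finset.sum_boole]
  exact_mod_cast card_powerset_separating hj hk h

theorem exists_large_corner {V : BddOp} (hV : ∀ j k, j / 2 = k / 2 → ⟪e j, V (e k)⟫_ℂ = 0)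
    (F : Finset ℕ) {δ : ℝ} (h : δ < ‖blockProj e F * V * blockProj e F‖) :
    ∃ G ⊆ F, δ / 4 < ‖blockProj e G * V * blockProj e ((F : Set ℕ) \ G)‖ := by
  by_contra! hG
  have h1 := congrArg norm (sum_powerset_corners hV F)
  rw [norm_smul, norm_smul, norm_pow, Complex.norm_ofNat, Complex.norm_ofNat] at h1
  have h2 := norm_sum_le_of_le F.powerset (fun G hGF => hG G (Finset.mem_powerset.1 hGF))
  rw [Finset.sum_const, Finset.card_powerset, nsmul_eq_mul] at h2
  push_cast at h2
  have h3 : (0 : ℝ) < 2 ^ F.card := by positivity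
  nlinarith

/-- A non-compact operator has large compressions to finite sets of blocks arbitrarily far out: it
differs from `(1 - P_N) V (1 - P_N)` by a finite-rank operator for each initial segment `N`. -/
theorem exists_large_compression {V : BddOp} (hV : ¬ IsCompactOperator V) :
    ∃ δ > 0, ∀ N : ℕ, ∃ F : Finset ℕ, (∀ n ∈ F, N ≤ n) ∧
      δ < ‖blockProj e F * V * blockProj e F‖ := by
  by_contra! hδ
  refine hV ?_
  let A : ℕ → BddOp := fun N => blockProj e (Set.Iio N)ᶜ * V * blockProj e (Set.Iio N)ᶜ
  have hA : Tendsto (fun N => V - A N) atTop (𝓝 V) := by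
    rw [Metric.tendsto_atTop]
    intro ε hε
    obtain ⟨N, hN⟩ := hδ (ε / 2) (by positivity)
    refine ⟨N, fun L hL => ?_⟩
    rw [dist_eq_norm, sub_sub_cancel_left, norm_neg]
    refine (norm_le_of_finite_compressions (e := e) (δ := ε / 2) fun M => ?_).trans_lt (by linarith)
    have h1 : blockProj e (Set.Iio M) * A L * blockProj e (Set.Iio M) =
        blockProj e (Finset.Ico L M : Finset ℕ) * V * blockProj e (Finset.Ico L M : Finset ℕ) := by
      have h2 : blockProj e (Set.Iio M) * blockProj e (Set.Iio L)ᶜ =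
          blockProj e (Finset.Ico L M : Finset ℕ) := by
        rw [blockProj_mul]
        congr 1
        ext n
        simp [and_comm]
      have h3 : blockProj e (Set.Iio L)ᶜ * blockProj e (Set.Iio M) =
          blockProj e (Finset.Ico L M : Finset ℕ) := by
        rw [blockProj_mul]
        congr 1
        ext n
        simp
      rw [← h2]
      nth_rw 2 [h2]
      rw [← h3]
      simp only [A, mul_assoc]
    rw [h1]
    exact hN _ fun n hn => hL.trans (Finset.mem_Ico.1 hn).1
  refine isCompactOperator_of_tendsto hA (Eventually.of_forall fun N => ?_)
  have hP := isCompactOperator_blockProj e (Set.finite_Iio N)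
  have h1 : V - A N = V * blockProj e (Set.Iio N) +
      blockProj e (Set.Iio N) * (V * blockProj e (Set.Iio N)ᶜ) := by
    simp only [A, blockProj_compl]
    noncomm_ring
  rw [h1]
  exact (hP.clm_comp V).add (hP.comp_clm _)

/-- An operator with vanishing diagonal blocks, all of whose corners `P_Y V (1 - P_Y)` are compact,
is compact. A non-compact `V` has, by averaging, corners of norm bounded below on infinitely many
pairwise disjoint finite sets of blocks, and these fit together to a non-compact corner. -/
theorem isCompactOperator_of_corners {V : BddOp}
    (hV : ∀ j k, j / 2 = k / 2 → ⟪e j, V (e k)⟫_ℂ = 0)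
    (hc : ∀ Y : Set ℕ, IsCompactOperator (blockProj e Y * V * blockProj e Yᶜ : BddOp)) :
    IsCompactOperator V := by
  by_contra hcon
  obtain ⟨δ, hδ, hF⟩ := exists_large_compression (e := e) hcon
  choose F hFN hFδ using hF
  choose G hGF hGδ using fun N => exists_large_corner hV (F N) (hFδ N)
  -- The sets `F (N j)` are pairwise disjoint, `F (N j)` lying in `[N j, N (j + 1))`.
  let N : ℕ → ℕ := fun j => (fun n => max n ((F n).sup id) + 1)^[j] 0
  have hNs : ∀ j, N (j + 1) = max (N j) ((F (N j)).sup id) + 1 := fun j =>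
    Function.iterate_succ_apply' _ _ _
  have hNm : StrictMono N := strictMono_nat_of_lt_succ fun j => by
    rw [hNs]; exact Nat.lt_succ_of_le (le_max_left _ _)
  have hFN' : ∀ j, ∀ n ∈ F (N j), n < N (j + 1) := fun j n hn => by
    rw [hNs]
    exact Nat.lt_succ_of_le ((Finset.le_sup (f := id) hn).trans (le_max_right _ _))
  have hdisj : ∀ i j n, n ∈ F (N i) → n ∈ F (N j) → i = j := by
    intro i j n hi hj
    have h1 := hFN' i n hi
    have h2 := hFN' j n hj
    have h3 := hFN _ n hi
    have h4 := hFN _ n hj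
    rcases lt_trichotomy i j with h | h | h
    · have := hNm.monotone (Nat.succ_le_of_lt h); simp only [Nat.succ_eq_add_one] at this; omega
    · exact h
    · have := hNm.monotone (Nat.succ_le_of_lt h); simp only [Nat.succ_eq_add_one] at this; omega
  -- By disjointness, the corner of `V` given by `Y` restricts on `F (N j)` to that given by `G (N j)`.
  let Y : Set ℕ := ⋃ j, (G (N j) : Set ℕ)
  have hY1 : ∀ j, (F (N j) : Set ℕ) ∩ Y = G (N j) := by
    intro j
    ext n
    simp only [Y, Set.mem_inter_iff, Set.mem_iUnion, Finset.mem_coe]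
    constructor
    · rintro ⟨h1, i, h2⟩
      rwa [hdisj j i n h1 (hGF _ h2)]
    · exact fun h => ⟨hGF _ h, j, h⟩
  have hY2 : ∀ j, Yᶜ ∩ (F (N j) : Set ℕ) = (F (N j) : Set ℕ) \ G (N j) := by
    intro j
    rw [← hY1 j]
    ext n
    simp only [Set.mem_inter_iff, Set.mem_compl_iff, Set.mem_sdiff]
    tauto
  set C := blockProj e Y * V * blockProj e Yᶜ with hC
  have hcorner : ∀ j, blockProj e (F (N j)) * C * blockProj e (F (N j)) =
      blockProj e (G (N j)) * V * blockProj e ((F (N j) : Set ℕ) \ G (N j)) := by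
    intro j
    rw [← hY2, ← hY1, ← blockProj_mul, ← blockProj_mul, hC]
    simp only [mul_assoc]
  choose x hx1 hx2 using fun j => ContinuousLinearMap.exists_lt_apply_of_lt_opNorm _ (hGδ (N j))
  -- The vectors `P_{F (N j)} (x j)` live on blocks moving off to infinity, so they are weakly null.
  have hweak : Tendsto (fun j => C (blockProj e (F (N j)) (x j))) atTop (𝓝 0) := by
    refine (hc Y).tendsto_zero_of_weakly_null (r := 1)
      (fun j => (norm_blockProj_apply_le _ _).trans (hx1 j).le) fun z => ?_
    have h0 : Tendsto (fun j => ‖z - blockProj e (Set.Iio (N j)) z‖) atTop (𝓝 0) := by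
      have := ((tendsto_blockProj_Iio e z).comp hNm.tendsto_atTop).const_sub z
      simpa using this.norm
    refine squeeze_zero_norm (fun j => ?_) h0
    have h1 : ⟪z, blockProj e (F (N j)) (x j)⟫_ℂ = ⟪blockProj e (F (N j)) z, x j⟫_ℂ := by
      conv_lhs => rw [← star_blockProj, ContinuousLinearMap.star_eq_adjoint,
        ContinuousLinearMap.adjoint_inner_right]
    have h2 : blockProj e (F (N j)) z =
        blockProj e (F (N j)) (z - blockProj e (Set.Iio (N j)) z) := by
      rw [map_sub, ← mul_apply_eq_comp, blockProj_mul]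
      have : (F (N j) : Set ℕ) ∩ Set.Iio (N j) = ∅ := by
        ext n
        simp only [Set.mem_inter_iff, Finset.mem_coe, Set.mem_Iio, Set.mem_empty_iff_false,
          iff_false, not_and, not_lt]
        exact hFN _ n
      rw [this]
      simp [blockProj]
    rw [h1, h2]
    refine (norm_inner_le_norm _ _).trans ?_
    refine (mul_le_mul (norm_blockProj_apply_le _ _) (hx1 j).le (norm_nonneg _)
      (norm_nonneg _)).trans ?_
    rw [mul_one]
  obtain ⟨j, hj⟩ := ((tendsto_zero_iff_norm_tendsto_zero.1 hweak).eventually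
    (gt_mem_nhds (show (0 : ℝ) < δ / 4 by positivity))).exists
  have h1 := hx2 j
  rw [← hcorner, mul_apply_eq_comp, mul_apply_eq_comp] at h1
  exact absurd (h1.trans_le (norm_blockProj_apply_le _ _)) (not_lt.2 hj.le)

/-- An operator commuting modulo compact operators with all the projections `P_Y` is a compact
perturbation of its block diagonal part. -/
theorem isCompactOperator_sub_blockPart {T : BddOp}
    (hT : ∀ Y : Set ℕ, IsCompactOperator (blockProj e Y * T - T * blockProj e Y : BddOp)) :
    IsCompactOperator (T - blockPart e T : BddOp) := by
  refine isCompactOperator_of_corners (e := e) (fun j k h => ?_) fun Y => ?_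
  · rw [sub_apply, inner_sub_right, inner_blockPart, if_pos h, sub_self]
  · have h1 := (commute_blockProj (blockPart_mem_blockDiag (e := e) T) Y).eq
    have h2 : blockProj e Y * (T - blockPart e T) * blockProj e Yᶜ =
        (blockProj e Y * T - T * blockProj e Y) * blockProj e Yᶜ := by
      have h3 : blockProj e Y * blockProj e Yᶜ = 0 := by
        rw [blockProj_mul, Set.inter_compl_self]
        simp [blockProj]
      simp only [mul_sub, h1, sub_mul, mul_assoc, h3, mul_zero]
    rw [h2]
    exact (hT Y).comp_clm _

end Blocks

section Blocks

variable {e : HilbertBasis ℕ ℂ Ell2}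

/-! ### The projections onto the rotated basis vectors -/

variable (e) in
/-- The projection onto the closed linear span of the vectors `f_{α, 2n}`. -/
noncomputable def rotProj (α : ℝ) : BddOp :=
  (Submodule.span ℂ (Set.range (rotEven e α))).topologicalClosure.starProjection

theorem isStarProjection_rotProj (α : ℝ) : IsStarProjection (rotProj e α) :=
  isStarProjection_starProjection

theorem rotProj_even (α : ℝ) (n : ℕ) : rotProj e α (rotEven e α n) = rotEven e α n := by
  unfold rotProj
  rw [Submodule.starProjection_eq_self_iff]
  exact Submodule.le_topologicalClosure _ (Submodule.subset_span ⟨n, rfl⟩)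

theorem inner_rotEven_rotOdd (α : ℝ) (m n : ℕ) : ⟪rotEven e α m, rotOdd e α n⟫_ℂ = 0 := by
  simp only [rotEven, rotOdd, inner_add_left, inner_sub_right, inner_smul_left, inner_smul_right,
    inner_basis, Complex.conj_ofReal]
  have h1 : 2 * m ≠ 2 * n + 1 := by omega
  have h2 : 2 * m + 1 ≠ 2 * n := by omega
  by_cases h : m = n
  · subst h
    simp only [h1, h2, if_true, if_false]
    ring
  · have h3 : 2 * m ≠ 2 * n := by omega
    have h4 : 2 * m + 1 ≠ 2 * n + 1 := by omega
    simp only [h1, h2, h3, h4, if_false]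
    ring

theorem rotProj_odd (α : ℝ) (n : ℕ) : rotProj e α (rotOdd e α n) = 0 := by
  unfold rotProj
  rw [Submodule.starProjection_apply_eq_zero_iff, Submodule.orthogonal_closure,
    Submodule.mem_orthogonal]
  intro u hu
  induction hu using Submodule.span_induction with
  | mem x hx =>
    obtain ⟨m, rfl⟩ := hx
    exact inner_rotEven_rotOdd α m n
  | zero => simp
  | add x y _ _ hx hy => rw [inner_add_left, hx, hy, add_zero]
  | smul a x _ hx => rw [inner_smul_left, hx, mul_zero]

theorem rot_sq_add {α : ℝ} (hα : α ^ 2 ≤ 1) :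
    (α : ℂ) * α + (Real.sqrt (1 - α ^ 2) : ℂ) * (Real.sqrt (1 - α ^ 2) : ℂ) = 1 := by
  rw [← Complex.ofReal_mul, ← Complex.ofReal_mul, ← Complex.ofReal_add,
    Real.mul_self_sqrt (by linarith)]
  norm_num [sq]

theorem basis_even_eq {α : ℝ} (hα : α ^ 2 ≤ 1) (n : ℕ) :
    e (2 * n) = (α : ℂ) • rotEven e α n + (Real.sqrt (1 - α ^ 2) : ℂ) • rotOdd e α n := by
  have h := rot_sq_add hα
  simp only [rotEven, rotOdd]
  generalize (Real.sqrt (1 - α ^ 2) : ℂ) = b at *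
  conv_lhs => rw [← one_smul ℂ (e (2 * n)), ← h]
  module

theorem basis_odd_eq {α : ℝ} (hα : α ^ 2 ≤ 1) (n : ℕ) :
    e (2 * n + 1) = (Real.sqrt (1 - α ^ 2) : ℂ) • rotEven e α n - (α : ℂ) • rotOdd e α n := by
  have h := rot_sq_add hα
  simp only [rotEven, rotOdd]
  generalize (Real.sqrt (1 - α ^ 2) : ℂ) = b at *
  conv_lhs => rw [← one_smul ℂ (e (2 * n + 1)), ← h]
  module

theorem rotProj_basis_even {α : ℝ} (hα : α ^ 2 ≤ 1) (n : ℕ) :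
    rotProj e α (e (2 * n)) = (α : ℂ) • rotEven e α n := by
  rw [basis_even_eq hα, map_add, map_smul, map_smul, rotProj_even, rotProj_odd, smul_zero, add_zero]

theorem rotProj_basis_odd {α : ℝ} (hα : α ^ 2 ≤ 1) (n : ℕ) :
    rotProj e α (e (2 * n + 1)) = (Real.sqrt (1 - α ^ 2) : ℂ) • rotEven e α n := by
  rw [basis_odd_eq hα, map_sub, map_smul, map_smul, rotProj_even, rotProj_odd, smul_zero, sub_zero]

theorem inner_rotEven_of_ne {α : ℝ} {j n : ℕ} (h : j / 2 ≠ n) : ⟪e j, rotEven e α n⟫_ℂ = 0 := by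
  have h1 : j ≠ 2 * n := by omega
  have h2 : j ≠ 2 * n + 1 := by omega
  simp [rotEven, inner_basis, h1, h2]

theorem rotProj_mem_blockDiag {α : ℝ} (hα : α ^ 2 ≤ 1) : rotProj e α ∈ blockDiag e := by
  rw [mem_blockDiag_iff_inner]
  intro j k h
  rcases Nat.even_or_odd' k with ⟨n, rfl | rfl⟩
  · rw [rotProj_basis_even hα, inner_smul_right, inner_rotEven_of_ne (by omega), mul_zero]
  · rw [rotProj_basis_odd hα, inner_smul_right, inner_rotEven_of_ne (by omega), mul_zero]

theorem clm_ext_of_rot {α : ℝ} (hα : α ^ 2 ≤ 1) {S T : BddOp}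
    (h0 : ∀ n, S (rotEven e α n) = T (rotEven e α n))
    (h1 : ∀ n, S (rotOdd e α n) = T (rotOdd e α n)) : S = T := by
  refine clm_ext_of_blocks e (fun n => ?_) fun n => ?_
  · simp only [basis_even_eq hα, map_add, map_smul, h0, h1]
  · simp only [basis_odd_eq hα, map_sub, map_smul, h0, h1]

theorem blockDiagOn_apply_rot {X : Set ℕ} {α : ℝ} {T : BddOp} (hT : T ∈ blockDiagOn e X) {n : ℕ}
    (hn : n ∉ X) : T (rotEven e α n) = 0 ∧ T (rotOdd e α n) = 0 := by
  obtain ⟨h0, h1⟩ := hT.2 n hn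
  simp [rotEven, rotOdd, h0, h1]

/-- The operators in `𝒟(X, α)` are those in `𝒜₀(X)` commuting with the projection onto the closed
span of the vectors `f_{α, 2n}`. -/
theorem mem_rotDiag_iff {X : Set ℕ} {α : ℝ} (hα : α ^ 2 ≤ 1) {T : BddOp} :
    T ∈ rotDiag e X α ↔ T ∈ blockDiagOn e X ∧ Commute (rotProj e α) T := by
  simp only [rotDiag, Set.mem_ofPred_eq]
  refine and_congr_right fun hT => ⟨fun h => ?_, fun h n _ => ?_⟩
  · refine clm_ext_of_rot (e := e) hα (fun n => ?_) fun n => ?_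
    · rw [mul_apply_eq_comp, mul_apply_eq_comp, rotProj_even]
      by_cases hn : n ∈ X
      · obtain ⟨a, ha⟩ := (h n hn).1
        rw [ha, map_smul, rotProj_even]
      · rw [(blockDiagOn_apply_rot hT hn).1, map_zero]
    · rw [mul_apply_eq_comp, mul_apply_eq_comp, rotProj_odd, map_zero]
      by_cases hn : n ∈ X
      · obtain ⟨b, hb⟩ := (h n hn).2
        rw [hb, map_smul, rotProj_odd, smul_zero]
      · rw [(blockDiagOn_apply_rot hT hn).2, map_zero]
  · have hblock : ∀ v : Ell2, (∃ x y : ℂ, v = x • e (2 * n) + y • e (2 * n + 1)) →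
        ∃ x y : ℂ, T v = x • e (2 * n) + y • e (2 * n + 1) := by
      rintro _ ⟨x, y, rfl⟩
      rw [map_add, map_smul, map_smul, blockDiag_apply_even hT.1, blockDiag_apply_odd hT.1]
      generalize ⟪e (2 * n), T (e (2 * n))⟫_ℂ = a
      generalize ⟪e (2 * n + 1), T (e (2 * n))⟫_ℂ = b
      generalize ⟪e (2 * n), T (e (2 * n + 1))⟫_ℂ = c
      generalize ⟪e (2 * n + 1), T (e (2 * n + 1))⟫_ℂ = d
      exact ⟨x * a + y * c, x * b + y * d, by module⟩
    have hcomm : ∀ v, rotProj e α (T v) = T (rotProj e α v) := fun v =>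
      congrArg (fun S : BddOp => S v) h.eq
    constructor
    · obtain ⟨x, y, hxy⟩ := hblock (rotEven e α n) ⟨_, _, rfl⟩
      refine ⟨x * α + y * Real.sqrt (1 - α ^ 2), ?_⟩
      have h1 := hcomm (rotEven e α n)
      rw [rotProj_even, hxy, map_add, map_smul, map_smul, rotProj_basis_even hα,
        rotProj_basis_odd hα] at h1
      rw [hxy, ← h1]
      module
    · obtain ⟨x, y, hxy⟩ := hblock (rotOdd e α n) ⟨Real.sqrt (1 - α ^ 2), -α, by
        rw [rotOdd]; module⟩
      refine ⟨x * Real.sqrt (1 - α ^ 2) - y * α, ?_⟩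
      have h1 := hcomm (rotOdd e α n)
      rw [rotProj_odd, hxy, map_add, map_smul, map_smul, rotProj_basis_even hα,
        rotProj_basis_odd hα, map_zero] at h1
      rw [hxy, basis_even_eq hα, basis_odd_eq hα, ← sub_eq_zero]
      refine Eq.trans ?_ h1
      module

theorem commute_of_mem_rotDiag {X : Set ℕ} {α : ℝ} (hα : α ^ 2 ≤ 1) {S T : BddOp}
    (hS : S ∈ rotDiag e X α) (hT : T ∈ rotDiag e X α) : Commute S T := by
  refine clm_ext_of_rot (e := e) hα (fun n => ?_) fun n => ?_ <;> by_cases hn : n ∈ X <;>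
    rw [mul_apply_eq_comp, mul_apply_eq_comp]
  · obtain ⟨a, ha⟩ := (hS.2 n hn).1
    obtain ⟨b, hb⟩ := (hT.2 n hn).1
    rw [ha, hb, map_smul, map_smul, ha, hb, smul_comm]
  · rw [(blockDiagOn_apply_rot hS.1 hn).1, (blockDiagOn_apply_rot hT.1 hn).1, map_zero, map_zero]
  · obtain ⟨a, ha⟩ := (hS.2 n hn).2
    obtain ⟨b, hb⟩ := (hT.2 n hn).2
    rw [ha, hb, map_smul, map_smul, ha, hb, smul_comm]
  · rw [(blockDiagOn_apply_rot hS.1 hn).2, (blockDiagOn_apply_rot hT.1 hn).2, map_zero, map_zero]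

/-! ### The algebra `ℳ` as a relative commutant modulo compact operators -/

theorem Calkin.commute_π_iff {S T : BddOp} :
    Commute (Calkin.π S) (Calkin.π T) ↔ IsCompactOperator (S * T - T * S : BddOp) := by
  rw [commute_iff_eq, ← map_mul, ← map_mul, Calkin.π_eq_iff]

theorem Calkin.π_eq_zero_iff {T : BddOp} : Calkin.π T = 0 ↔ IsCompactOperator T := by
  rw [← map_zero Calkin.π, Calkin.π_eq_iff, sub_zero]

theorem blockProj_mul_mul_blockProj {T : BddOp} (hT : T ∈ blockDiag e) (X : Set ℕ) :
    blockProj e X * T * blockProj e X = T * blockProj e X := by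
  rw [(commute_blockProj hT X).eq, mul_assoc, blockProj_mul_self]

/-- The diagonal part of `a` relative to an idempotent `q` commutes with `q`. -/
theorem commute_pinching {R : Type*} [Ring R] {q : R} (hq : q * q = q) (a : R) :
    Commute q (q * a * q + (1 - q) * a * (1 - q)) := by
  have h1 : q * (1 - q) = 0 := by rw [mul_sub, mul_one, hq, sub_self]
  have h2 : (1 - q) * q = 0 := by rw [sub_mul, one_mul, hq, sub_self]
  rw [commute_iff_eq, mul_add, add_mul, ← mul_assoc, ← mul_assoc, ← mul_assoc q (_ * a), ← mul_assoc q,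
    hq, h1, mul_assoc (q * a), hq, mul_assoc _ (1 - q) q, h2]
  simp

/-- The off-diagonal part of `a` relative to an idempotent `q` lies in the ideal generated by the
commutator of `q` and `a`. -/
theorem sub_pinching {R : Type*} [Ring R] {q : R} (hq : q * q = q) (a : R) :
    a - (q * a * q + (1 - q) * a * (1 - q)) =
      (q * a - a * q) * (1 - q) - (q * a - a * q) * q := by
  simp only [mul_sub, sub_mul, mul_assoc, hq, one_mul, mul_one]
  abel

/-- A compression `P_X T P_X` lies in `𝒟_𝒦(X, α)` if and only if `T` commutes modulo compact
operators with the projection onto the closed span of the vectors `f_{α, 2n}`, `n ∈ X`. -/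
theorem compression_mem_rotDiagCompact_iff {X : Set ℕ} {α : ℝ} (hα : α ^ 2 ≤ 1) {T : BddOp}
    (hT : T ∈ blockDiag e) :
    blockProj e X * T * blockProj e X ∈ rotDiagCompact e X α ↔
      Commute (Calkin.π (blockProj e X * rotProj e α)) (Calkin.π T) := by
  have hq := rotProj_mem_blockDiag (e := e) hα
  have hPq := (commute_blockProj hq X).eq
  have hPT := (commute_blockProj hT X).eq
  have hA := mul_blockProj_mem_blockDiagOn hT X
  rw [blockProj_mul_mul_blockProj hT]
  -- The commutator of `T` with `P_X q` is that of the compression `T P_X` with `q`.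
  have hcomm : blockProj e X * rotProj e α * T - T * (blockProj e X * rotProj e α) =
      rotProj e α * (T * blockProj e X) - T * blockProj e X * rotProj e α := by
    rw [hPq, mul_assoc, hPT, ← hPq, mul_assoc]
  rw [Calkin.commute_π_iff, hcomm]
  constructor
  · rintro ⟨-, S, hS, R, -, hR, h⟩
    have h1 := ((mem_rotDiag_iff hα).1 hS).2.eq
    rw [h, mul_add, add_mul, h1, add_sub_add_left_eq_sub]
    exact (hR.clm_comp (rotProj e α)).sub (hR.comp_clm (rotProj e α))
  · intro hK
    set A := T * blockProj e X
    set q := rotProj e α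
    have hqq : q * q = q := (isStarProjection_rotProj α).isIdempotentElem
    have h1q : 1 - q ∈ blockDiag e := by
      rw [← mem_blockDiagAlgebra] at hq ⊢
      exact sub_mem (one_mem _) hq
    have hS : q * A * q + (1 - q) * A * (1 - q) ∈ blockDiagOn e X := by
      rw [mem_blockDiagOn_iff] at hA ⊢
      refine ⟨add_mem_blockDiag (mul_mem_blockDiag (mul_mem_blockDiag hq hA.1) hq)
        (mul_mem_blockDiag (mul_mem_blockDiag h1q hA.1) h1q), ?_⟩
      have h1 := (commute_blockProj hq X).eq
      have h2 := (commute_blockProj h1q X).eq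
      have h3 : ∀ p : BddOp, blockProj e X * p = p * blockProj e X →
          p * A * p * blockProj e X = p * A * p := fun p hp => by
        rw [mul_assoc, ← hp, ← mul_assoc, mul_assoc p A, hA.2]
      rw [add_mul, h3 q h1, h3 _ h2]
    refine ⟨hA, _, (mem_rotDiag_iff hα).2 ⟨hS, ?_⟩,
      A - (q * A * q + (1 - q) * A * (1 - q)), ?_, ?_, (add_sub_cancel _ _).symm⟩
    · exact commute_pinching hqq A
    · rw [mem_blockDiagOn_iff] at hA hS ⊢
      exact ⟨sub_mem_blockDiag hA.1 hS.1, by rw [sub_mul, hA.2, hS.2]⟩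
    · rw [sub_pinching hqq]
      exact (hK.comp_clm (1 - q)).sub (hK.comp_clm q)

end Blocks

theorem IsCoherent.sq_le {𝒳 : Set (Set ℕ)} {α : 𝒳 → ℝ} (hα : IsCoherent 𝒳 α) (X : 𝒳) :
    α X ^ 2 ≤ 1 := by
  have h := hα.1 X
  nlinarith [h.1, h.2]

section Blocks

variable {e : HilbertBasis ℕ ℂ Ell2}

/-! ### The masa -/

/-- If the blocks of `W` did not tend to zero, the infinite set of the blocks of norm at least some
`ε > 0` would meet a member of the wide family in an infinite set. -/
theorem isCompactOperator_of_wide {𝒳 : Set (Set ℕ)} (h𝒳 : IsWide 𝒳) {W : BddOp}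
    (hW : W ∈ blockDiag e)
    (h : ∀ X ∈ 𝒳, IsCompactOperator (W * blockProj e X : BddOp)) : IsCompactOperator W := by
  refine isCompactOperator_of_mem_blockDiag hW ?_
  rw [tendsto_zero_iff_norm_tendsto_zero, Metric.tendsto_atTop]
  by_contra! hcon
  obtain ⟨ε, hε, hbad⟩ := hcon
  let Z : Set ℕ := {n | ∃ k, k / 2 = n ∧ ε ≤ ‖W (e k)‖}
  have hZ : Z.Infinite := by
    refine Set.infinite_of_not_bddAbove ?_
    rintro ⟨B, hB⟩
    obtain ⟨k, hk, hk2⟩ := hbad (2 * B + 2)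
    have : k / 2 ≤ B := hB ⟨k, rfl, by simpa using hk2⟩
    omega
  obtain ⟨X, hX, hXZ⟩ := h𝒳 Z hZ
  have ht := tendsto_zero_iff_norm_tendsto_zero.1 ((h X hX).tendsto_basis e)
  obtain ⟨N, hN⟩ := Metric.tendsto_atTop.1 ht ε hε
  obtain ⟨n, ⟨hnX, k, hkn, hk⟩, hnN⟩ := hXZ.exists_gt N
  have h1 := hN k (by omega)
  rw [mul_apply_eq_comp, blockProj_basis_of_mem e (by rwa [hkn])] at h1
  simp only [dist_zero_right, norm_norm] at h1
  exact absurd hk (not_le.2 h1)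

variable (e) in
/-- The set of projections in the Calkin algebra consisting of the images of all `P_X`, `X ⊆ ℕ`,
and of the projections onto the closed spans of `{f_{α_X, 2n} : n ∈ X}`, `X ∈ 𝒳`. -/
noncomputable def generatorSet (𝒳 : Set (Set ℕ)) (α : 𝒳 → ℝ) : Set Calkin :=
  Set.range (fun Y : Set ℕ => Calkin.π (blockProj e Y)) ∪
    Set.range (fun X : 𝒳 => Calkin.π (blockProj e X * rotProj e (α X)))

theorem star_eq_of_mem_generatorSet {𝒳 : Set (Set ℕ)} {α : 𝒳 → ℝ} (hα : IsCoherent 𝒳 α)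
    {x : Calkin} (hx : x ∈ generatorSet e 𝒳 α) : star x = x := by
  obtain ⟨Y, rfl⟩ | ⟨X, rfl⟩ := hx
  · simp only [Calkin.star_π, star_blockProj]
  · simp only
    rw [Calkin.star_π, star_mul, star_blockProj, (isStarProjection_rotProj _).isSelfAdjoint.star_eq,
      (commute_blockProj (rotProj_mem_blockDiag (hα.sq_le X)) _).eq]

variable (e) in
/-- The commutant in the Calkin algebra of the projections in `generatorSet`. It coincides with
`π[ℳ]`. -/
noncomputable def blockMasa (𝒳 : Set (Set ℕ)) (α : 𝒳 → ℝ) : StarSubalgebra ℂ Calkin :=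
  StarSubalgebra.centralizer ℂ (generatorSet e 𝒳 α)

theorem mem_blockMasa {𝒳 : Set (Set ℕ)} {α : 𝒳 → ℝ} (hα : IsCoherent 𝒳 α) {x : Calkin} :
    x ∈ blockMasa e 𝒳 α ↔ (∀ Y : Set ℕ, Commute (Calkin.π (blockProj e Y)) x) ∧
      ∀ X : 𝒳, Commute (Calkin.π (blockProj e X * rotProj e (α X))) x := by
  rw [blockMasa, StarSubalgebra.mem_centralizer_iff]
  constructor
  · exact fun h => ⟨fun Y => (h _ (Or.inl ⟨Y, rfl⟩)).1, fun X => (h _ (Or.inr ⟨X, rfl⟩)).1⟩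
  · intro h g hg
    rw [star_eq_of_mem_generatorSet hα hg, and_self]
    obtain ⟨Y, rfl⟩ | ⟨X, rfl⟩ := hg
    · exact h.1 Y
    · exact h.2 X

theorem mem_blockAlgebra_iff {𝒳 : Set (Set ℕ)} {α : 𝒳 → ℝ} (hα : IsCoherent 𝒳 α) {T : BddOp} :
    T ∈ blockAlgebra e 𝒳 α ↔ T ∈ blockDiag e ∧ Calkin.π T ∈ blockMasa e 𝒳 α := by
  rw [mem_blockMasa hα]
  simp only [blockAlgebra, Set.mem_ofPred_eq]
  refine and_congr_right fun hT => ?_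
  have h1 : ∀ Y : Set ℕ, Commute (Calkin.π (blockProj e Y)) (Calkin.π T) := fun Y =>
    (commute_blockProj hT Y).map Calkin.π
  simp only [h1, implies_true, true_and]
  exact forall_congr' fun X => compression_mem_rotDiagCompact_iff (hα.sq_le X) hT

/-- The commutant of `generatorSet` is `π[ℳ]`: a representative of an element of the commutant can be
replaced by its block diagonal part. -/
theorem coe_blockMasa {𝒳 : Set (Set ℕ)} {α : 𝒳 → ℝ} (hα : IsCoherent 𝒳 α) :
    (blockMasa e 𝒳 α : Set Calkin) = Calkin.π '' blockAlgebra e 𝒳 α := by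
  ext x
  constructor
  · intro hx
    obtain ⟨T, rfl⟩ := Calkin.π_surjective x
    have h : Calkin.π (blockPart e T) = Calkin.π T := by
      rw [eq_comm, Calkin.π_eq_iff]
      exact isCompactOperator_sub_blockPart fun Y =>
        Calkin.commute_π_iff.1 (((mem_blockMasa hα).1 hx).1 Y)
    refine ⟨blockPart e T, (mem_blockAlgebra_iff hα).2 ⟨blockPart_mem_blockDiag T, ?_⟩, h⟩
    rwa [h]
  · rintro ⟨T, hT, rfl⟩
    exact ((mem_blockAlgebra_iff hα).1 hT).2

theorem blockMasa_commute {𝒳 : Set (Set ℕ)} {α : 𝒳 → ℝ} (h𝒳 : IsWide 𝒳) (hα : IsCoherent 𝒳 α)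
    {x y : Calkin} (hx : x ∈ blockMasa e 𝒳 α) (hy : y ∈ blockMasa e 𝒳 α) : Commute x y := by
  rw [← SetLike.mem_coe, coe_blockMasa hα] at hx hy
  obtain ⟨S, hS, rfl⟩ := hx
  obtain ⟨T, hT, rfl⟩ := hy
  rw [Calkin.commute_π_iff]
  refine isCompactOperator_of_wide h𝒳 (sub_mem_blockDiag (mul_mem_blockDiag hS.1 hT.1)
    (mul_mem_blockDiag hT.1 hS.1)) fun X hX => ?_
  obtain ⟨-, S', hS', R, -, hR, hSR⟩ := hS.2 ⟨X, hX⟩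
  obtain ⟨-, T', hT', R', -, hR', hTR⟩ := hT.2 ⟨X, hX⟩
  rw [blockProj_mul_mul_blockProj hS.1] at hSR
  rw [blockProj_mul_mul_blockProj hT.1] at hTR
  simp only at hSR hTR
  have hcomp : ∀ {U V : BddOp}, V ∈ blockDiag e →
      U * V * blockProj e X = (U * blockProj e X) * (V * blockProj e X) := fun {U V} hV => by
    rw [mul_assoc U (blockProj e X), ← mul_assoc (blockProj e X) V, blockProj_mul_mul_blockProj hV,
      mul_assoc]
  rw [← Calkin.π_eq_zero_iff, sub_mul, hcomp hT.1, hcomp hS.1, hSR, hTR]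
  simp only [map_sub, map_mul, map_add, Calkin.π_eq_zero_iff.2 hR, Calkin.π_eq_zero_iff.2 hR', add_zero]
  rw [← map_mul, ← map_mul, (commute_of_mem_rotDiag (hα.sq_le _) hS' hT').eq, sub_self]

/-- Coherence enters here: if `X ∩ Y` is infinite, the two projections are built from the same
rotated basis, and otherwise their commutator has finite rank. -/
theorem commute_π_rotProj {𝒳 : Set (Set ℕ)} {α : 𝒳 → ℝ} (hα : IsCoherent 𝒳 α) (X Y : 𝒳) :
    Commute (Calkin.π (blockProj e X * rotProj e (α X)))
      (Calkin.π (blockProj e Y * rotProj e (α Y))) := by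
  have hX := rotProj_mem_blockDiag (e := e) (hα.sq_le X)
  have hY := rotProj_mem_blockDiag (e := e) (hα.sq_le Y)
  have hprod : ∀ {U V : BddOp}, U ∈ blockDiag e → ∀ A B : Set ℕ,
      (blockProj e A * U) * (blockProj e B * V) = blockProj e (A ∩ B) * (U * V) := by
    intro U V hU A B
    rw [← blockProj_mul, mul_assoc, mul_assoc, ← mul_assoc U, ← (commute_blockProj hU B).eq,
      mul_assoc]
  by_cases h : ((X : Set ℕ) ∩ Y).Infinite
  · refine Commute.map ?_ Calkin.π
    rw [commute_iff_eq, hprod hX, hprod hY, hα.2 X Y h, Set.inter_comm]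
  · rw [Calkin.commute_π_iff, hprod hX, hprod hY, Set.inter_comm (Y : Set ℕ), ← mul_sub]
    exact (isCompactOperator_blockProj e (Set.not_infinite.1 h)).comp_clm _

theorem π_blockScalar_mem {𝒳 : Set (Set ℕ)} {α : 𝒳 → ℝ} (hα : IsCoherent 𝒳 α) (c : BddSeq) :
    Calkin.π (blockScalar e c) ∈ blockMasa e 𝒳 α := by
  rw [mem_blockMasa hα]
  refine ⟨fun Y => ?_, fun X => ?_⟩
  · exact (commute_blockProj (blockScalar_mem_blockDiag c) Y).map Calkin.π
  · exact (commute_blockScalar (mul_mem_blockDiag (blockProj_mem_blockDiag _)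
      (rotProj_mem_blockDiag (hα.sq_le X))) c).symm.map Calkin.π

theorem generatorSet_subset_blockMasa {𝒳 : Set (Set ℕ)} {α : 𝒳 → ℝ} (hα : IsCoherent 𝒳 α) :
    generatorSet e 𝒳 α ⊆ blockMasa e 𝒳 α := by
  rintro _ (⟨Y, rfl⟩ | ⟨X, rfl⟩)
  · simp only [blockProj_eq]
    exact π_blockScalar_mem hα _
  · refine (mem_blockMasa hα).2 ⟨fun Y => ?_, fun Y => commute_π_rotProj hα Y X⟩
    exact (commute_blockProj (mul_mem_blockDiag (blockProj_mem_blockDiag _)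
      (rotProj_mem_blockDiag (hα.sq_le X))) Y).map Calkin.π

theorem isClosed_blockMasa (e : HilbertBasis ℕ ℂ Ell2) (𝒳 : Set (Set ℕ)) (α : 𝒳 → ℝ) :
    IsClosed (blockMasa e 𝒳 α : Set Calkin) :=
  Set.isClosed_centralizer _

theorem isMasa_blockMasa {𝒳 : Set (Set ℕ)} {α : 𝒳 → ℝ} (h𝒳 : IsWide 𝒳) (hα : IsCoherent 𝒳 α) :
    Calkin.IsMasa (blockMasa e 𝒳 α) := by
  refine ⟨⟨isClosed_blockMasa e 𝒳 α, fun x hx y hy => blockMasa_commute h𝒳 hα hx hy⟩, ?_⟩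
  intro B hB hle x hx
  rw [blockMasa, StarSubalgebra.mem_centralizer_iff]
  intro g hg
  have h := hB.2 g (hle (generatorSet_subset_blockMasa hα hg)) x hx
  exact ⟨h, by rw [star_eq_of_mem_generatorSet hα hg]; exact h⟩

/-! ### Approximation by projections -/

/-- Block scalars are norm limits of linear combinations of the projections `P_X`. -/
theorem exists_blockScalar_approx (e : HilbertBasis ℕ ℂ Ell2) (c : BddSeq) {ε : ℝ} (hε : 0 < ε) :
    ∃ (t : Finset ℂ) (Y : ℂ → Set ℕ),
      ‖blockScalar e c - ∑ z ∈ t, z • blockProj e (Y z)‖ ≤ ε := by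
  obtain ⟨t, -, htf, hcov⟩ := Metric.finite_approx_of_totallyBounded
    (isCompact_closedBall (0 : ℂ) ‖c‖).totallyBounded ε hε
  have hg : ∀ n, ∃ z ∈ t, dist (c n) z < ε := fun n => by
    have := hcov (show c n ∈ Metric.closedBall 0 ‖c‖ by simpa using c.norm_apply_le n)
    simpa using this
  choose g hgt hgc using hg
  let d : BddSeq := BddSeq.ofBound (fun n => c n - g n) ε fun n => by
    simpa [dist_eq_norm] using (hgc n).le
  refine ⟨htf.toFinset, fun z => g ⁻¹' {z}, ?_⟩
  have h : blockScalar e c - ∑ z ∈ htf.toFinset, z • blockProj e (g ⁻¹' {z}) = blockScalar e d := by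
    refine clm_ext_of_basis e fun k => ?_
    rw [sub_apply, sum_apply, Finset.sum_eq_single (g (k / 2)), smul_apply,
      blockProj_basis_of_mem e (by simp), blockScalar_basis, blockScalar_basis, ← sub_smul]
    · rfl
    · intro z _ hz
      rw [smul_apply, blockProj_basis_of_notMem e (by simpa using hz.symm), smul_zero]
    · intro hz
      exact absurd (htf.mem_toFinset.2 (hgt _)) hz
  rw [h]
  exact (norm_blockScalar_le e d).trans (BddSeq.norm_ofBound_le _ _ _)

/-- The square of a self-adjoint block diagonal operator with traceless blocks is a block scalar,
since the square of a traceless `2 × 2` matrix is a scalar. -/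
theorem sq_eq_blockScalar_of_traceless {S : BddOp} (hS : S ∈ blockDiag e) (hsa : star S = S)
    (htr : ∀ n, ⟪e (2 * n), S (e (2 * n))⟫_ℂ + ⟪e (2 * n + 1), S (e (2 * n + 1))⟫_ℂ = 0) :
    ∃ ρ : ℕ → ℝ, ∃ hρ : ∀ n, ‖(ρ n : ℂ)‖ ≤ ‖S‖ ^ 2, (∀ n, 0 ≤ ρ n) ∧
      S * S = blockScalar e (BddSeq.ofBound (fun n => (ρ n : ℂ)) (‖S‖ ^ 2) hρ) := by
  have hsymm : ∀ x y, ⟪x, S y⟫_ℂ = ⟪S x, y⟫_ℂ := fun x y => by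
    conv_lhs => rw [← hsa, ContinuousLinearMap.star_eq_adjoint,
      ContinuousLinearMap.adjoint_inner_right]
  have hρ : ∀ n, ‖((‖S (e (2 * n))‖ ^ 2 : ℝ) : ℂ)‖ ≤ ‖S‖ ^ 2 := fun n => by
    rw [Complex.norm_real, Real.norm_of_nonneg (by positivity)]
    gcongr
    simpa [norm_basis] using S.le_opNorm (e (2 * n))
  refine ⟨fun n => ‖S (e (2 * n))‖ ^ 2, hρ, fun n => by positivity, ?_⟩
  have key : ∀ n, (S * S) (e (2 * n)) = ((‖S (e (2 * n))‖ ^ 2 : ℝ) : ℂ) • e (2 * n) ∧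
      (S * S) (e (2 * n + 1)) = ((‖S (e (2 * n))‖ ^ 2 : ℝ) : ℂ) • e (2 * n + 1) := by
    intro n
    have h0 := blockDiag_apply_even hS n
    have h1 := blockDiag_apply_odd hS n
    rw [eq_neg_of_add_eq_zero_right (htr n)] at h1
    have hn : ((‖S (e (2 * n))‖ ^ 2 : ℝ) : ℂ) =
        ⟪e (2 * n), S (e (2 * n))⟫_ℂ * ⟪e (2 * n), S (e (2 * n))⟫_ℂ +
        ⟪e (2 * n + 1), S (e (2 * n))⟫_ℂ * ⟪e (2 * n), S (e (2 * n + 1))⟫_ℂ := by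
      have h2 : ((‖S (e (2 * n))‖ ^ 2 : ℝ) : ℂ) = ⟪e (2 * n), S (S (e (2 * n)))⟫_ℂ := by
        rw [hsymm, inner_self_eq_norm_sq_to_K]
        norm_cast
      rw [h2]
      conv_lhs => rw [h0]
      simp only [map_add, map_smul, inner_add_right, inner_smul_right]
    rw [hn, mul_apply_eq_comp, mul_apply_eq_comp]
    generalize ⟪e (2 * n), S (e (2 * n))⟫_ℂ = s at *
    generalize ⟪e (2 * n + 1), S (e (2 * n))⟫_ℂ = b at *
    generalize ⟪e (2 * n), S (e (2 * n + 1))⟫_ℂ = b' at *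
    constructor
    · rw [h0, map_add, map_smul, map_smul, h0, h1]
      module
    · rw [h1, map_add, map_smul, map_smul, h0, h1]
      module
  refine clm_ext_of_blocks e (fun n => ?_) fun n => ?_
  · rw [(key n).1, blockScalar_basis, BddSeq.ofBound_apply]
    congr 6; omega
  · rw [(key n).2, blockScalar_basis, BddSeq.ofBound_apply]
    congr 6; omega

/-- The block scalar `m` is half the trace of the blocks of `T`. -/
theorem exists_traceless_sub (e : HilbertBasis ℕ ℂ Ell2) {T : BddOp} (hsa : star T = T) :
    ∃ m : BddSeq, star (T - blockScalar e m) = T - blockScalar e m ∧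
      ∀ n, ⟪e (2 * n), (T - blockScalar e m) (e (2 * n))⟫_ℂ +
        ⟪e (2 * n + 1), (T - blockScalar e m) (e (2 * n + 1))⟫_ℂ = 0 := by
  have hreal : ∀ k, star ⟪e k, T (e k)⟫_ℂ = ⟪e k, T (e k)⟫_ℂ := fun k => by
    conv_rhs => rw [← hsa, ContinuousLinearMap.star_eq_adjoint,
      ContinuousLinearMap.adjoint_inner_right]
    exact inner_conj_symm _ _
  let m : BddSeq := BddSeq.ofBound
    (fun n => (⟪e (2 * n), T (e (2 * n))⟫_ℂ + ⟪e (2 * n + 1), T (e (2 * n + 1))⟫_ℂ) / 2) ‖T‖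
    fun n => by
      rw [norm_div, Complex.norm_ofNat, div_le_iff₀ (by norm_num)]
      refine (norm_add_le _ _).trans ?_
      linarith [norm_entry_le (e := e) T (2 * n) (2 * n),
        norm_entry_le (e := e) T (2 * n + 1) (2 * n + 1)]
  have hm : star m = m := by
    ext n
    simp only [lp.star_apply, m, BddSeq.ofBound_apply, star_div₀, star_add, hreal, star_ofNat]
  refine ⟨m, by rw [star_sub, star_blockScalar, hsa, hm], fun n => ?_⟩
  have h1 : 2 * n / 2 = n := by omega
  have h2 : (2 * n + 1) / 2 = n := by omega
  simp only [sub_apply, inner_sub_right, inner_blockScalar, h1, h2, inner_basis, if_true, m,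
    BddSeq.ofBound_apply]
  ring

/-- A self-adjoint block diagonal operator is approximated by a combination of block scalars and a
projection: on the blocks where the two eigenvalues are at distance at least `2 ε`, the projection
is the spectral projection for the larger eigenvalue; the remaining blocks are almost scalar. -/
theorem exists_spectral_approx {T : BddOp} (hT : T ∈ blockDiag e) (hsa : star T = T) {ε : ℝ}
    (hε : 0 < ε) :
    ∃ (m r w : BddSeq) (Y : Set ℕ) (p : BddOp), IsStarProjection p ∧
      p = (1 / 2 : ℂ) • (blockProj e Y + blockScalar e w * (T - blockScalar e m)) ∧
      ‖T - (blockScalar e m + blockScalar e r * ((2 : ℂ) • p - blockProj e Y))‖ ≤ ε := by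
  obtain ⟨m, hSsa, htr⟩ := exists_traceless_sub e hsa
  have hS : T - blockScalar e m ∈ blockDiag e :=
    sub_mem_blockDiag hT (blockScalar_mem_blockDiag m)
  set S := T - blockScalar e m with hSdef
  obtain ⟨ρ, hρb, hρ0, hSS⟩ := sq_eq_blockScalar_of_traceless hS hSsa htr
  let Y : Set ℕ := {n | ε ^ 2 ≤ ρ n}
  have hsqrt : ∀ n ∈ Y, ε ≤ √(ρ n) := fun n hn => Real.le_sqrt_of_sq_le hn
  classical
  let r : BddSeq := BddSeq.ofBound (fun n => (√(ρ n) : ℂ)) ‖S‖ fun n => by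
    rw [Complex.norm_real, Real.norm_of_nonneg (Real.sqrt_nonneg _)]
    refine Real.sqrt_le_iff.2 ⟨norm_nonneg _, ?_⟩
    simpa [abs_of_nonneg (hρ0 n)] using hρb n
  let w : BddSeq := BddSeq.ofBound (fun n => if n ∈ Y then (((√(ρ n))⁻¹ : ℝ) : ℂ) else 0) ε⁻¹
    fun n => by
      split_ifs with hn
      · rw [Complex.norm_real, Real.norm_of_nonneg (by positivity)]
        exact inv_anti₀ hε (hsqrt n hn)
      · simpa using hε.le
  have hw : star w = w := by
    ext n
    simp only [lp.star_apply, w, BddSeq.ofBound_apply]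
    split_ifs <;> simp
  -- `w` is the inverse of `r` on `Y`, so `u = w S` is a symmetry there and `S = r u`.
  have hrw : r * w = BddSeq.ind Y := by
    ext n
    rw [lp.infty_coeFn_mul, Pi.mul_apply]
    by_cases hn : n ∈ Y
    · have : (√(ρ n) : ℂ) ≠ 0 := by
        exact_mod_cast (hε.trans_le (hsqrt n hn)).ne'
      rw [BddSeq.ind_of_mem hn]
      simp [r, w, hn, this]
    · rw [BddSeq.ind_of_notMem hn]
      simp [w, hn]
  set u := blockScalar e w * S with hu
  have hwS := (commute_blockScalar hS w).eq
  have husa : star u = u := by rw [hu, star_mul, star_blockScalar, hw, hSsa, hwS]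
  have hPu : blockProj e Y * u = u := by
    rw [hu, blockProj_eq, ← mul_assoc, blockScalar_mul]
    congr 2
    ext n
    rw [lp.infty_coeFn_mul, Pi.mul_apply]
    by_cases hn : n ∈ Y
    · rw [BddSeq.ind_of_mem hn, one_mul]
    · simp [w, hn]
  have huP : u * blockProj e Y = u := by
    have := congrArg star hPu
    rwa [star_mul, husa, star_blockProj] at this
  have huu : u * u = blockProj e Y := by
    have h1 : u * u = blockScalar e w * blockScalar e w * (S * S) := by
      rw [hu, mul_assoc, ← mul_assoc S, ← hwS]
      simp only [mul_assoc]
    rw [h1, hSS, blockScalar_mul, blockScalar_mul, blockProj_eq]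
    congr 1
    ext n
    rw [lp.infty_coeFn_mul, Pi.mul_apply, lp.infty_coeFn_mul, Pi.mul_apply]
    by_cases hn : n ∈ Y
    · have h2 : (√(ρ n)) ≠ 0 := (hε.trans_le (hsqrt n hn)).ne'
      have h3 : (√(ρ n))⁻¹ * (√(ρ n))⁻¹ * ρ n = 1 := by
        nth_rw 3 [← Real.mul_self_sqrt (hρ0 n)]
        field_simp
      rw [BddSeq.ind_of_mem hn]
      simp only [w, BddSeq.ofBound_apply, if_pos hn]
      exact_mod_cast h3
    · rw [BddSeq.ind_of_notMem hn]
      simp [w, hn]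
  refine ⟨m, r, w, Y, (1 / 2 : ℂ) • (blockProj e Y + u), ⟨?_, ?_⟩, rfl, ?_⟩
  · rw [IsIdempotentElem, smul_mul_smul_comm, add_mul, mul_add, mul_add, blockProj_mul_self, hPu,
      huP, huu]
    module
  · rw [isSelfAdjoint_iff, star_smul, star_add, star_blockProj, husa]
    simp
  · have h1 : (2 : ℂ) • (1 / 2 : ℂ) • (blockProj e Y + u) - blockProj e Y = u := by module
    have h2 : T - (blockScalar e m + blockScalar e r * u) = blockProj e Yᶜ * S := by
      rw [hu, ← mul_assoc, blockScalar_mul, hrw, ← blockProj_eq, blockProj_compl, sub_mul, one_mul,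
        hSdef, sub_add_eq_sub_sub]
    rw [h1, h2]
    have h3 : star (blockProj e Yᶜ * S) * (blockProj e Yᶜ * S) =
        blockScalar e (BddSeq.ind Yᶜ * BddSeq.ofBound (fun n => (ρ n : ℂ)) (‖S‖ ^ 2) hρb) := by
      rw [← blockScalar_mul, ← blockProj_eq, ← hSS, star_mul, star_blockProj, hSsa, mul_assoc,
        ← mul_assoc _ _ S, blockProj_mul_self, ← mul_assoc, ← (commute_blockProj hS _).eq, mul_assoc]
    have h4 : ‖blockProj e Yᶜ * S‖ * ‖blockProj e Yᶜ * S‖ ≤ ε ^ 2 := by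
      rw [← CStarRing.norm_star_mul_self, h3]
      refine (norm_blockScalar_le e _).trans (lp.norm_le_of_forall_le (by positivity) fun n => ?_)
      rw [lp.infty_coeFn_mul, Pi.mul_apply]
      by_cases hn : n ∈ Y
      · rw [BddSeq.ind_of_notMem (by simpa using hn), zero_mul, norm_zero]
        positivity
      · rw [BddSeq.ind_of_mem hn, one_mul, BddSeq.ofBound_apply, Complex.norm_real,
          Real.norm_of_nonneg (hρ0 n)]
        exact (not_le.1 hn).le
    exact abs_le_of_sq_le_sq' (by nlinarith) hε.le |>.2

theorem isGeneratedByProjections_blockMasa {𝒳 : Set (Set ℕ)} {α : 𝒳 → ℝ} (hα : IsCoherent 𝒳 α) :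
    Calkin.IsGeneratedByProjections (blockMasa e 𝒳 α) := by
  set A := blockMasa e 𝒳 α with hA
  set G : StarSubalgebra ℂ Calkin :=
    StarAlgebra.adjoin ℂ {p : Calkin | p ∈ A ∧ IsStarProjection p} with hG
  have hproj : ∀ p : BddOp, IsStarProjection p → Calkin.π p ∈ A → Calkin.π p ∈ G := fun p hp hpA =>
    StarAlgebra.subset_adjoin ℂ _ ⟨hpA, by rw [IsIdempotentElem, ← map_mul, hp.isIdempotentElem.eq],
      by rw [isSelfAdjoint_iff, Calkin.star_π, hp.isSelfAdjoint.star_eq]⟩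
  let C : Subalgebra ℂ Calkin := G.toSubalgebra.topologicalClosure
  have hGC : ∀ x ∈ G, x ∈ C := fun x hx => G.toSubalgebra.le_topologicalClosure hx
  have happrox : ∀ T : BddOp, (∀ ε > 0, ∃ S, Calkin.π S ∈ C ∧ ‖T - S‖ ≤ ε) → Calkin.π T ∈ C := by
    intro T hT
    have hcl : IsClosed (C : Set Calkin) := G.toSubalgebra.isClosed_topologicalClosure
    rw [← SetLike.mem_coe, ← hcl.closure_eq, Metric.mem_closure_iff]
    intro ε hε
    obtain ⟨S, hS, hTS⟩ := hT (ε / 2) (by positivity)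
    refine ⟨_, hS, ?_⟩
    rw [dist_eq_norm, ← map_sub]
    exact ((Calkin.norm_π_le _).trans hTS).trans_lt (by linarith)
  have hP : ∀ Y : Set ℕ, Calkin.π (blockProj e Y) ∈ C := fun Y =>
    hGC _ (hproj _ (isStarProjection_blockProj e Y) (generatorSet_subset_blockMasa hα
      (Or.inl ⟨Y, rfl⟩)))
  have hscalar : ∀ c : BddSeq, Calkin.π (blockScalar e c) ∈ C := fun c => by
    refine happrox _ fun ε hε => ?_
    obtain ⟨t, Y, h⟩ := exists_blockScalar_approx e c hε
    refine ⟨_, ?_, h⟩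
    rw [map_sum]
    refine sum_mem fun z _ => ?_
    rw [map_smul]
    exact C.smul_mem (hP _) z
  have hselfAdj : ∀ T ∈ blockDiag e, star T = T → Calkin.π T ∈ A → Calkin.π T ∈ C := by
    intro T hT hsa hTA
    refine happrox T fun ε hε => ?_
    obtain ⟨m, r, w, Y, p, hp, hpeq, h⟩ := exists_spectral_approx hT hsa hε
    refine ⟨_, ?_, h⟩
    have hpA : Calkin.π p ∈ A := by
      rw [hpeq, map_smul, map_add, map_mul, map_sub]
      exact A.smul_mem (add_mem (generatorSet_subset_blockMasa hα (Or.inl ⟨Y, rfl⟩))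
        (mul_mem (π_blockScalar_mem hα w) (sub_mem hTA (π_blockScalar_mem hα m)))) _
    rw [map_add, map_mul, map_sub, map_smul]
    exact add_mem (hscalar m) (mul_mem (hscalar r)
      (sub_mem (C.smul_mem (hGC _ (hproj p hp hpA)) _) (hP Y)))
  refine Set.Subset.antisymm (fun x hx => ?_) ?_
  · rw [coe_blockMasa hα] at hx
    obtain ⟨T, hT, rfl⟩ := hx
    obtain ⟨hTb, hTA⟩ := (mem_blockAlgebra_iff hα).1 hT
    have hTb' := star_mem_blockDiag hTb
    have hTA' : Calkin.π (star T) ∈ A := by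
      rw [← Calkin.star_π]
      exact star_mem hTA
    have h1 : Calkin.π (T + star T) ∈ C := by
      refine hselfAdj _ (add_mem_blockDiag hTb hTb') (by rw [star_add, star_star, add_comm]) ?_
      rw [map_add]
      exact add_mem hTA hTA'
    have h2 : Calkin.π (Complex.I • (T - star T)) ∈ C := by
      refine hselfAdj _ ?_ ?_ ?_
      · have := sub_mem_blockDiag hTb hTb'
        rw [← mem_blockDiagAlgebra] at this ⊢
        exact (blockDiagAlgebra e).smul_mem this _
      · rw [star_smul, star_sub, star_star, Complex.star_def, Complex.conj_I, neg_smul, ← smul_neg,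
          neg_sub]
      · rw [map_smul, map_sub]
        exact A.smul_mem (sub_mem hTA hTA') _
    have h3 : T = (1 / 2 : ℂ) • (T + star T) +
        (-Complex.I / 2 : ℂ) • (Complex.I • (T - star T)) := by
      rw [smul_smul, div_mul_eq_mul_div, neg_mul, Complex.I_mul_I]
      module
    change Calkin.π T ∈ C
    rw [h3, map_add, map_smul, map_smul (Calkin.π)]
    exact add_mem (C.smul_mem h1 _) (C.smul_mem h2 _)
  · refine closure_minimal ?_ (isClosed_blockMasa e 𝒳 α)
    exact StarAlgebra.adjoin_le fun p hp => hp.1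

end Blocks

theorem proposition4p16 (e : HilbertBasis ℕ ℂ Ell2) (𝒳 : Set (Set ℕ)) (h𝒳 : IsWide 𝒳)
    (α : 𝒳 → ℝ) (hα : IsCoherent 𝒳 α) :
    ∃ A : StarSubalgebra ℂ Calkin,
      (A : Set Calkin) = Calkin.π '' blockAlgebra e 𝒳 α ∧
      Calkin.IsMasa A ∧ Calkin.IsGeneratedByProjections A :=
  ⟨blockMasa e 𝒳 α, coe_blockMasa hα, isMasa_blockMasa h𝒳 hα, isGeneratedByProjections_blockMasa hα⟩
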